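/- Let $D$ be a circled bounded symmetric domain in a finite-dimensional complex vector space $V$, and let $\{x\,y\,z\}$ be the positive Hermitian Jordan triple system on $V=T_0D$ associated to $D$ (the one for which every vector field $z\mapsto v-\tfrac12\{z\,v\,z\}$, $v\in V$, is complete on $D$). Put $D(x,y)z=\{x\,y\,z\}$, and equip the projective space $\mathbb P(V)\cong\mathbb{CP}^n$ with the Fubini–Study metric of the Hermitian inner product $(x\,|\,y)=\operatorname{tr}D(x,y)$. An element $e\in V$ is a tripotent if $\tfrac12\{e\,e\,e\}=e$; tripotents $e,f$ are orthogonal if $D(e,f)=0$; a nonzero tripotent is primitive if it is not the sum of two nonzero orthogonal tripotents; a frame is a maximal system of mutually orthogonal primitive tripotents. Every $x\in V$ can be written $x=\sum_i\lambda_ie_i$ with $(e_i)$ a frame and $\lambda_1\ge\lambda_2\ge\cdots\ge0$, and $\operatorname{rank}(x)$ is the number of nonzero $\lambda_i$. Let $\pi:V\setminus\{0\}\to\mathbb P(V)$ be the projection and $$S^1(D)=\{\pi(x):\operatorname{rank}(x)=1\}\subset\mathbb P(V)$$ the first Mok characteristic variety. Then: 1. $S^1(D)$ is an extrinsically symmetric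 complex submanifold of $\mathbb P(V)$ (its dimension may vary between connected components if $D$ is reducible): for every $p\in S^1(D)$ there is an isometry $\sigma_p$ of $\mathbb P(V)$ such that $\sigma_p(p)=p$, $\sigma_p(S^1(D))=S^1(D)$, and $d\sigma_p$ at $p$ is $-\mathrm{Id}$ on $T_pS^1(D)$ and $\mathrm{Id}$ on the normal space $\nu_pS^1(D)$. 2. The second fundamental form $\alpha$ of $S^1(D)$ in $\mathbb P(V)$ is parallel: $\nabla^{\perp}\alpha=0$. 3. Let $e$ be a primitive tripotent and $V_k(e)=\{z\in V:\{e\,e\,z\}=kz\}$. Then $\pi(e)\in S^1(D)$; there is exactly one invertible $\mathbb C$-linear map $\sigma:V\to V$ with $\sigma=-\mathrm{Id}$ on $V_1(e)$ and $\sigma=\mathrm{Id}$ on $V_0(e)$ and on $V_2(e)$; it is an automorphism of the triple system, i.e. $\sigma\{x\,y\,z\}=\{\sigma x\,\sigma y\,\sigma z\}$ for all $x,y,z\in V$, and the map it induces on $\mathbb P(V)$ is a symmetry of $S^1(D)$ at $\pi(e)$ in the sense of 1. -/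

import Mathlib

/-! ### Hermitian Jordan triple systems -/

/-- A positive Hermitian Jordan triple system on `V`: the triple product `{x y z}` is linear and
symmetric in `x` and `z` and antilinear in `y`, it satisfies the Jordan identity, and
`tr D(x, x) > 0` for `x ≠ 0`, where `D(x, y) z = {x y z}`. -/
structure PosHermJordanTriple (V : Type*) [AddCommGroup V] [Module ℂ V] where
  /-- The operator `D`: `D x y z = {x y z}`. -/
  D : V →ₗ[ℂ] V →ₗ⋆[ℂ] V →ₗ[ℂ] V
  symm : ∀ x y z, D x y z = D z y x
  jordan : ∀ x y u v w,
    D x y (D u v w) = D (D x y u) v w - D u (D v x y) w + D u v (D x y w)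
  pos : ∀ x, x ≠ 0 → 0 < (LinearMap.trace ℂ V (D x x)).re ∧ (LinearMap.trace ℂ V (D x x)).im = 0

namespace PosHermJordanTriple

/-- `e` is a tripotent: `½ {e e e} = e`. -/
def IsTripotent {V : Type*} [AddCommGroup V] [Module ℂ V] (J : PosHermJordanTriple V)
    (e : V) : Prop :=
  (1 / 2 : ℂ) • J.D e e e = e

/-- Orthogonality of tripotents. -/
def Orthogonal {V : Type*} [AddCommGroup V] [Module ℂ V] (J : PosHermJordanTriple V)
    (e₁ e₂ : V) : Prop :=
  J.D e₁ e₂ = 0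

/-- `e` is a primitive tripotent: a nonzero tripotent that is not the sum of two nonzero
orthogonal tripotents. -/
def IsPrimitive {V : Type*} [AddCommGroup V] [Module ℂ V] (J : PosHermJordanTriple V)
    (e : V) : Prop :=
  J.IsTripotent e ∧ e ≠ 0 ∧
    ¬ ∃ e₁ e₂ : V, J.IsTripotent e₁ ∧ J.IsTripotent e₂ ∧ e₁ ≠ 0 ∧ e₂ ≠ 0 ∧
      J.Orthogonal e₁ e₂ ∧ e = e₁ + e₂

/-- The Peirce space `V_α(e) = {z : {e e z} = α z}`. -/
def peirce {V : Type*} [AddCommGroup V] [Module ℂ V] (J : PosHermJordanTriple V)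
    (e : V) (α : ℂ) : Submodule ℂ V :=
  Module.End.eigenspace (J.D e e) α

/-- `e₁, …, e_r` is a frame: a maximal system of mutually orthogonal primitive tripotents. -/
def IsFrame {V : Type*} [AddCommGroup V] [Module ℂ V] (J : PosHermJordanTriple V)
    {r : ℕ} (e : Fin r → V) : Prop :=
  (∀ i, J.IsPrimitive (e i)) ∧ (∀ i j, i ≠ j → J.Orthogonal (e i) (e j)) ∧
    ∀ f, J.IsPrimitive f → ¬ ∀ i, J.Orthogonal (e i) f

/-- `rank(x) = k`: in a spectral decomposition `x = λ₁ e₁ + ⋯ + λ_r e_r` with respect to a frame,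
`λ₁ ≥ ⋯ ≥ λ_r ≥ 0`, exactly `k` of the `λ_i` are nonzero. -/
def HasRank {V : Type*} [AddCommGroup V] [Module ℂ V] (J : PosHermJordanTriple V)
    (x : V) (k : ℕ) : Prop :=
  ∃ (r : ℕ) (e : Fin r → V) (c : Fin r → ℝ), J.IsFrame e ∧ Antitone c ∧ (∀ i, 0 ≤ c i) ∧
    x = ∑ i, (c i : ℂ) • e i ∧ Set.ncard {i | c i ≠ 0} = k

/-- The `j`-th Mok characteristic variety `{π(x) : 1 ≤ rank(x) ≤ j}` in the projective space
of `V`. -/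
def mokVariety {V : Type*} [AddCommGroup V] [Module ℂ V] (J : PosHermJordanTriple V)
    (j : ℕ) : Set (Projectivization ℂ V) :=
  {p | ∃ (x : V) (hx : x ≠ 0), p = Projectivization.mk ℂ x hx ∧
    ∃ k, 1 ≤ k ∧ k ≤ j ∧ J.HasRank x k}

/-- `σ` is an automorphism of the triple system. -/
def IsAutomorphism {V : Type*} [AddCommGroup V] [Module ℂ V] (J : PosHermJordanTriple V)
    (σ : V ≃ₗ[ℂ] V) : Prop :=
  ∀ x y z, σ (J.D x y z) = J.D (σ x) (σ y) (σ z)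

/-- The linear map `σ` is `-Id` on `V₁(e)` and `Id` on `V₀(e)` and on `V₂(e)`. -/
def IsPeirceReflection {V : Type*} [AddCommGroup V] [Module ℂ V] (J : PosHermJordanTriple V)
    (e : V) (σ : V ≃ₗ[ℂ] V) : Prop :=
  (∀ z ∈ J.peirce e 1, σ z = -z) ∧ (∀ z ∈ J.peirce e 0, σ z = z) ∧ ∀ z ∈ J.peirce e 2, σ z = z

/-- The Hermitian inner product `(x | y) = tr D(x, y)`. -/
noncomputable def herm {V : Type*} [AddCommGroup V] [Module ℂ V] (J : PosHermJordanTriple V)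
    (x y : V) : ℂ :=
  LinearMap.trace ℂ V (J.D x y)

/-- The orthogonal complement of `x` for `(· | ·)`. -/
def perp {V : Type*} [AddCommGroup V] [Module ℂ V] (J : PosHermJordanTriple V)
    (x : V) : Submodule ℂ V where
  carrier := {z | J.herm z x = 0}
  add_mem' := by
    intro a b ha hb
    simp only [Set.mem_ofPred_eq, herm] at *
    simp [ha, hb]
  zero_mem' := by simp [herm]
  smul_mem' := by
    intro c a ha
    simp only [Set.mem_ofPred_eq, herm] at *
    simp [ha]

theorem add_perp_ne_zero {V : Type*} [AddCommGroup V] [Module ℂ V] (J : PosHermJordanTriple V)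
    {x : V} (hx : x ≠ 0) (z : J.perp x) : x + (z : V) ≠ 0 := by
  intro h
  have hz : J.herm (z : V) x = 0 := z.2
  have h1 : (z : V) = -x := by rw [eq_neg_iff_add_eq_zero, add_comm]; exact h
  rw [h1] at hz
  have h2 := (J.pos x hx).1
  simp only [herm, map_neg, LinearMap.neg_apply, neg_eq_zero] at hz
  rw [hz] at h2
  simp at h2

end PosHermJordanTriple

/-! ### Circled bounded symmetric domains -/

/-- `D` is a circled bounded symmetric domain in `V`. The symmetry at `z` is an involutive
holomorphic automorphism of `D` having `z` as an isolated fixed point. -/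
structure IsCircledBoundedSymmetricDomain {V : Type*} [NormedAddCommGroup V] [NormedSpace ℂ V]
    (D : Set V) : Prop where
  isOpen : IsOpen D
  isConnected : IsConnected D
  isBounded : Bornology.IsBounded D
  zero_mem : (0 : V) ∈ D
  circled : ∀ z ∈ D, ∀ t : ℝ, Complex.exp (t * Complex.I) • z ∈ D
  symmetry : ∀ z ∈ D, ∃ s : V → V, DifferentiableOn ℂ s D ∧ Set.MapsTo s D D ∧
    (∀ w ∈ D, s (s w) = w) ∧ s z = z ∧ ∀ᶠ w in nhdsWithin z {z}ᶜ, s w ≠ w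

/-- `J` is the triple system on `V = T₀D` associated to the circled bounded symmetric domain `D`:
for every `v`, the vector field `z ↦ v - ½ {z v z}` is complete on `D`, i.e. it generates a
one-parameter group of automorphisms of `D`. -/
def PosHermJordanTriple.IsAssociatedTo {V : Type*} [NormedAddCommGroup V] [NormedSpace ℂ V]
    (J : PosHermJordanTriple V) (D : Set V) : Prop :=
  ∀ v : V, ∀ z ∈ D, ∃ γ : ℝ → V, γ 0 = z ∧
    ∀ t, γ t ∈ D ∧ HasDerivAt γ (v - (1 / 2 : ℂ) • J.D (γ t) v (γ t)) t

/-! ### Submanifolds of a vector space with a Riemannian metric `g`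

Below `E` is a chart domain (a whole vector space) and `g z u v` is a Riemannian metric on `E`. -/

namespace ChartGeometry

/-- The Christoffel map `Γ_z(u, v)` of the Levi-Civita connection of `g`: the vector with
`2 g(Γ(u, v), w) = ∂_u g(v, w) + ∂_v g(u, w) - ∂_w g(u, v)` for all `w`, so that
`∇_X Y = DY(X) + Γ(X, Y)`. -/
noncomputable def christoffel {E : Type*} [NormedAddCommGroup E] [NormedSpace ℝ E]
    (g : E → E → E → ℝ) (z u v : E) : E :=
  Classical.epsilon fun c : E => ∀ w : E, 2 * g z c w =
    fderiv ℝ (fun y => g y v w) z u + fderiv ℝ (fun y => g y u w) z v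
      - fderiv ℝ (fun y => g y u v) z w

/-- The component of `y` normal to the subspace `T`, with respect to the inner product `g z`. -/
noncomputable def normalPart {E : Type*} [NormedAddCommGroup E] [NormedSpace ℝ E]
    (g : E → E → E → ℝ) (z : E) (T : Submodule ℝ E) (y : E) : E :=
  Classical.epsilon fun n : E => (∀ t ∈ T, g z n t = 0) ∧ y - n ∈ T

/-- For a map `f` and constant fields `a`, `b` on its domain, the ambient covariant derivative
`∇_a (df b)` along `f`. -/
noncomputable def covDeriv {P E : Type*} [NormedAddCommGroup P] [NormedSpace ℝ P]
    [NormedAddCommGroup E] [NormedSpace ℝ E]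
    (g : E → E → E → ℝ) (f : P → E) (t a b : P) : E :=
  fderiv ℝ (fun s => fderiv ℝ f s b) t a + christoffel g (f t) (fderiv ℝ f t a) (fderiv ℝ f t b)

/-- The second fundamental form `α(a, b)` at `t` of the immersion `f`: the normal part of
`∇_a (df b)`. -/
noncomputable def secondFF {P E : Type*} [NormedAddCommGroup P] [NormedSpace ℝ P]
    [NormedAddCommGroup E] [NormedSpace ℝ E]
    (g : E → E → E → ℝ) (f : P → E) (t a b : P) : E :=
  normalPart g (f t) (LinearMap.range (fderiv ℝ f t).toLinearMap) (covDeriv g f t a b)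

/-- The induced connection of the immersion `f`: the vector `c` such that `df c` is the tangential
part of `∇_a (df b)`. -/
noncomputable def inducedConn {P E : Type*} [NormedAddCommGroup P] [NormedSpace ℝ P]
    [NormedAddCommGroup E] [NormedSpace ℝ E]
    (g : E → E → E → ℝ) (f : P → E) (t a b : P) : P :=
  Classical.epsilon fun c : P => fderiv ℝ f t c = covDeriv g f t a b - secondFF g f t a b

/-- The normal covariant derivative `∇^⊥_a ξ` at `t` of a normal field `ξ` along the
immersion `f`. -/
noncomputable def normalDeriv {P E : Type*} [NormedAddCommGroup P] [NormedSpace ℝ P]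
    [NormedAddCommGroup E] [NormedSpace ℝ E]
    (g : E → E → E → ℝ) (f : P → E) (ξ : P → E) (t a : P) : E :=
  normalPart g (f t) (LinearMap.range (fderiv ℝ f t).toLinearMap)
    (fderiv ℝ ξ t a + christoffel g (f t) (fderiv ℝ f t a) (ξ t))

/-- The covariant derivative of the second fundamental form,
`(∇_a α)(b, c) = ∇^⊥_a (α(b, c)) - α(∇_a b, c) - α(b, ∇_a c)`, for constant fields `b`, `c`. -/
noncomputable def derivSecondFF {P E : Type*} [NormedAddCommGroup P] [NormedSpace ℝ P]
    [NormedAddCommGroup E] [NormedSpace ℝ E]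
    (g : E → E → E → ℝ) (f : P → E) (t a b c : P) : E :=
  normalDeriv g f (fun s => secondFF g f s b c) t a
    - secondFF g f t (inducedConn g f t a b) c - secondFF g f t b (inducedConn g f t a c)

/-- `f : W → S` is a holomorphic parametrization of a neighbourhood of `f 0` in the embedded
complex submanifold `S`: an injective holomorphic immersion that is a homeomorphism onto a
relatively open subset of `S`. -/
structure IsLocalParam {E : Type*} [NormedAddCommGroup E] [NormedSpace ℂ E] (S : Set E) {d : ℕ}
    (W : Set (Fin d → ℂ)) (f : (Fin d → ℂ) → E) : Prop where
  isOpen : IsOpen W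
  zero_mem : 0 ∈ W
  holomorphic : DifferentiableOn ℂ f W
  immersion : ∀ t ∈ W, Function.Injective (fderiv ℂ f t)
  injOn : Set.InjOn f W
  relOpen : ∀ U ⊆ W, IsOpen U → ∃ O : Set E, IsOpen O ∧ f '' U = S ∩ O

/-- The tangent vectors to `S` at `z`: velocities at `z` of curves in `S`. -/
def tangentSet {E : Type*} [NormedAddCommGroup E] [NormedSpace ℝ E] (S : Set E) (z : E) : Set E :=
  {u | ∃ γ : ℝ → E, γ 0 = z ∧ (∀ᶠ t in nhds (0 : ℝ), γ t ∈ S) ∧ HasDerivAt γ u 0}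

end ChartGeometry

/-! ### Geometry of the projective space with the Fubini-Study metric of `(x | y) = tr D(x, y)` -/

namespace PosHermJordanTriple

/-- The affine chart of the projective space centred at `[x]`, on the orthogonal complement
of `x`: `z ↦ [x + z]`. Its image is the open set of all `[y]` with `(y | x) ≠ 0`. -/
noncomputable def chart {V : Type*} [AddCommGroup V] [Module ℂ V] (J : PosHermJordanTriple V)
    {x : V} (hx : x ≠ 0) (z : J.perp x) : Projectivization ℂ V :=
  Projectivization.mk ℂ (x + (z : V)) (J.add_perp_ne_zero hx z)

/-- The Fubini-Study metric in the affine chart centred at `[x]`: with `y = x + z`,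
`g_z(u, v) = Re ((u | v) / (y | y) - (u | y) (y | v) / (y | y)²)`. -/
noncomputable def fubiniStudy {V : Type*} [AddCommGroup V] [Module ℂ V]
    (J : PosHermJordanTriple V) (x : V) (z u v : J.perp x) : ℝ :=
  (J.herm (u : V) v / J.herm (x + z) (x + z)
    - J.herm (u : V) (x + z) * J.herm (x + z) (v : V) / J.herm (x + z) (x + z) ^ 2).re

/-- `F` represents `σ` near `[x]` in the affine charts centred at `[x]` and at `[y]`. -/
def IsChartRep {V : Type*} [NormedAddCommGroup V] [NormedSpace ℂ V] (J : PosHermJordanTriple V)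
    (σ : Projectivization ℂ V → Projectivization ℂ V) {x y : V} (hx : x ≠ 0) (hy : y ≠ 0)
    (F : J.perp x → J.perp y) : Prop :=
  ∀ᶠ z in nhds (0 : J.perp x), σ (J.chart hx z) = J.chart hy (F z)

/-- `σ` is an isometry of the projective space with its Fubini-Study metric: a bijection which is
smooth and whose differential at each point preserves the metric. -/
def IsFubiniStudyIsometry {V : Type*} [NormedAddCommGroup V] [NormedSpace ℂ V]
    (J : PosHermJordanTriple V) (σ : Projectivization ℂ V → Projectivization ℂ V) : Prop :=
  Function.Bijective σ ∧
    ∀ (x y : V) (hx : x ≠ 0) (hy : y ≠ 0),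
      σ (Projectivization.mk ℂ x hx) = Projectivization.mk ℂ y hy →
      ∃ F : J.perp x → J.perp y, J.IsChartRep σ hx hy F ∧
        ContDiffAt ℝ ((⊤ : ℕ∞) : WithTop ℕ∞) F 0 ∧
        ∀ u v, J.fubiniStudy y 0 (fderiv ℝ F 0 u) (fderiv ℝ F 0 v) = J.fubiniStudy x 0 u v

/-- `M` is an (embedded) complex submanifold of the projective space; the dimension may depend
on the connected component. -/
def IsComplexSubmanifold {V : Type*} [NormedAddCommGroup V] [NormedSpace ℂ V]
    (J : PosHermJordanTriple V) (M : Set (Projectivization ℂ V)) : Prop :=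
  ∀ (x : V) (hx : x ≠ 0), Projectivization.mk ℂ x hx ∈ M →
    ∃ (d : ℕ) (W : Set (Fin d → ℂ)) (f : (Fin d → ℂ) → J.perp x),
      ChartGeometry.IsLocalParam (J.chart hx ⁻¹' M) W f ∧ f 0 = 0

/-- `σ` is an extrinsic symmetry of `M` at `p`: an isometry of the ambient projective space that
fixes `p`, preserves `M`, and whose differential at `p` is `-Id` on `T_p M` and `Id` on the normal
space of `M` at `p`. -/
def IsExtrinsicSymmetry {V : Type*} [NormedAddCommGroup V] [NormedSpace ℂ V]
    (J : PosHermJordanTriple V) (M : Set (Projectivization ℂ V)) (p : Projectivization ℂ V)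
    (σ : Projectivization ℂ V → Projectivization ℂ V) : Prop :=
  J.IsFubiniStudyIsometry σ ∧ σ p = p ∧ σ '' M = M ∧
    ∀ (x : V) (hx : x ≠ 0), Projectivization.mk ℂ x hx = p →
      ∃ F : J.perp x → J.perp x, J.IsChartRep σ hx hx F ∧ DifferentiableAt ℝ F 0 ∧
        (∀ u ∈ ChartGeometry.tangentSet (J.chart hx ⁻¹' M) 0, fderiv ℝ F 0 u = -u) ∧
        ∀ ξ, (∀ u ∈ ChartGeometry.tangentSet (J.chart hx ⁻¹' M) 0, J.fubiniStudy x 0 ξ u = 0) →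
          fderiv ℝ F 0 ξ = ξ

/-- `M` is an extrinsically symmetric complex submanifold of the projective space. -/
def IsExtrinsicallySymmetric {V : Type*} [NormedAddCommGroup V] [NormedSpace ℂ V]
    (J : PosHermJordanTriple V) (M : Set (Projectivization ℂ V)) : Prop :=
  J.IsComplexSubmanifold M ∧ ∀ p ∈ M, ∃ σ, J.IsExtrinsicSymmetry M p σ

/-- The complex submanifold `M` has parallel second fundamental form with respect to the
Fubini-Study metric: at every point `[x]` of `M`, computed in the affine chart centred at `[x]` and
in any local parametrization of `M`, the tensor `∇α` vanishes. -/
def HasParallelSecondFF {V : Type*} [NormedAddCommGroup V] [NormedSpace ℂ V]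
    (J : PosHermJordanTriple V) (M : Set (Projectivization ℂ V)) : Prop :=
  ∀ (x : V) (hx : x ≠ 0), Projectivization.mk ℂ x hx ∈ M →
    ∀ (d : ℕ) (W : Set (Fin d → ℂ)) (f : (Fin d → ℂ) → J.perp x),
      ChartGeometry.IsLocalParam (J.chart hx ⁻¹' M) W f → f 0 = 0 →
      ∀ a b c : Fin d → ℂ,
        ChartGeometry.derivSecondFF (J.fubiniStudy x) f 0 a b c = 0

end PosHermJordanTriple

/-!
The theorem is a consequence of one algebraic fact: for a primitive tripotent `e` the Peirce space
`V₂(e)` is the line `ℂ e` (`peirce_two_of_isPrimitive`). To see this, consider the real form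
`{z ∈ V₂(e) : ½ {e z e} = z}`, which is closed under the triple product. The quartic form
`({x x x} | x)`, normalised by `(x | x)²`, has a maximum on it; the first order condition says
`{x x x} = c x`, so `x` is a multiple of a tripotent, which by primitivity of `e` can only be `±e`;
and `e` violates the second order condition in every direction orthogonal to `e`. Hence the real
form is `ℝ e`.

It follows that the elements of rank one are the nonzero `x` with `{x V x} ⊆ ℂ x`
(`mk_mem_mokVariety_iff`), a description which is invariant under automorphisms. The curve
`exp(t D(u, e)) e = e + t u + ½ t² {u e u}` with `u ∈ V₁(e)` consists of such
elements, and `e + u + w` with `w ∈ V₀(e)` is one only if `w = ½ {u e u}`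
(`isRankOne_smul_add_iff`). So in the affine chart centred at `[r e]` the first characteristic
variety is the graph of the quadratic map `u ↦ ½ r⁻¹ {u e u}` from `V₁(e)` to `V₀(e)`
(`preimage_chart_eq`). In particular it is a complex submanifold with tangent space `V₁(e)` and
normal space `V₀(e)` at `[e]`.

The Peirce reflection acts by `(-1)ⁿ` on `Vₙ(e)`, so the Peirce rules
`{V_a V_b V_c} ⊆ V_{a - b + c}` make it an automorphism. Automorphisms preserve the trace form and
the elements of rank one, hence act by isometries of the Fubini-Study metric which preserve the
variety, and the Peirce reflection is the symmetry at `[e]`.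

That `∇^⊥ α = 0` is computed in the same chart. The Christoffel map of the Fubini-Study metric is
`-(θ(u) v + θ(v) u)`, with a form `θ` that vanishes at the origin (`christoffel_fubiniStudy`); its
values on tangent vectors are tangent, so `α` is the normal part of the second derivative of a
parametrization, which up to tangent vectors is `β(b, c) = form (df b) (df c)`. The derivative of
this normal part at the origin is controlled by a normal frame (`normalFrame`), and the derivative
of `β` is cancelled by the terms with the induced connection (`derivSecondFF_eq_zero`).
-/

/-! ### The trace form and the Jordan identity -/

namespace PosHermJordanTriple

section Algebra

variable {V : Type*} [AddCommGroup V] [Module ℂ V] (J : PosHermJordanTriple V)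

/-- The Jordan identity, solved for the term with the triple product in the middle slot. -/
theorem jordan_middle (x y u v w : V) :
    J.D u (J.D v x y) w = J.D (J.D x y u) v w + J.D u v (J.D x y w) - J.D x y (J.D u v w) := by
  rw [J.jordan x y u v w]; abel

theorem herm_add_left (x y z : V) : J.herm (x + y) z = J.herm x z + J.herm y z := by
  simp [herm]

theorem herm_add_right (x y z : V) : J.herm x (y + z) = J.herm x y + J.herm x z := by
  simp [herm]

theorem herm_sub_left (x y z : V) : J.herm (x - y) z = J.herm x z - J.herm y z := by
  simp [herm]

theorem herm_sub_right (x y z : V) : J.herm x (y - z) = J.herm x y - J.herm x z := by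
  simp [herm]

theorem herm_smul_left (c : ℂ) (x y : V) : J.herm (c • x) y = c * J.herm x y := by
  simp [herm]

theorem herm_smul_right (c : ℂ) (x y : V) : J.herm x (c • y) = starRingEnd ℂ c * J.herm x y := by
  simp [herm]

theorem herm_neg_left (x y : V) : J.herm (-x) y = -J.herm x y := by simp [herm]

@[simp] theorem herm_zero_left (x : V) : J.herm 0 x = 0 := by simp [herm]

@[simp] theorem herm_zero_right (x : V) : J.herm x 0 = 0 := by simp [herm]

theorem herm_self_im (x : V) : (J.herm x x).im = 0 := by
  rcases eq_or_ne x 0 with rfl | h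
  · simp
  · exact (J.pos x h).2

theorem herm_self_pos {x : V} (hx : x ≠ 0) : 0 < (J.herm x x).re := (J.pos x hx).1

theorem herm_self_ne_zero {x : V} (hx : x ≠ 0) : J.herm x x ≠ 0 := by
  intro h
  have := J.herm_self_pos hx
  simp [h] at this

/-- The trace form is Hermitian: this is polarization of `tr D(x, x) ∈ ℝ`. -/
theorem herm_conj (x y : V) : starRingEnd ℂ (J.herm x y) = J.herm y x := by
  have h1 := J.herm_self_im (x + y)
  have h2 := J.herm_self_im (x + Complex.I • y)
  simp only [herm_add_left, herm_add_right, herm_smul_left, herm_smul_right, Complex.add_im,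
    J.herm_self_im, Complex.mul_im, Complex.conj_I, Complex.neg_re, Complex.neg_im, Complex.I_re,
    Complex.I_im, Complex.add_re, Complex.mul_re] at h1 h2
  apply Complex.ext
  · simp only [Complex.conj_re]; linarith
  · simp only [Complex.conj_im]; linarith

theorem herm_self_ofReal (x : V) : J.herm x x = ((J.herm x x).re : ℂ) :=
  Complex.ext (by simp) (by simp [J.herm_self_im])

/-- `D(y, x)` is the adjoint of `D(x, y)`: take traces in the Jordan identity. -/
theorem herm_adjoint (x y u v : V) : J.herm (J.D x y u) v = J.herm u (J.D y x v) := by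
  have h : J.D x y ∘ₗ J.D u v
      = J.D (J.D x y u) v - J.D u (J.D v x y) + J.D u v ∘ₗ J.D x y := by
    ext w
    simpa using J.jordan x y u v w
  have h2 := congrArg (LinearMap.trace ℂ V) h
  have h3 : LinearMap.trace ℂ V (J.D x y ∘ₗ J.D u v) = LinearMap.trace ℂ V (J.D u v ∘ₗ J.D x y) :=
    LinearMap.trace_mul_comm ℂ (J.D x y) (J.D u v)
  rw [map_add, map_sub, h3, J.symm v x y] at h2
  simp only [herm]
  linear_combination -h2

theorem D_eq_zero_of_swap {x y : V} (h : J.D x y = 0) : J.D y x = 0 := by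
  ext z
  by_contra hz
  apply J.herm_self_ne_zero hz
  rw [herm_adjoint, h]
  simp

/-! ### Elements with `{x x x} = λ x` and Peirce decomposition -/

section Cube

variable {J} {x : V} {c : ℂ} (hx : J.D x x x = c • x)
include hx

theorem triple_triple_of_cube (z : V) :
    J.D x (J.D x z x) x = (2 : ℂ) • J.D x x (J.D x x z) - c • J.D x x z := by
  have h := J.jordan_middle z x x x x
  rw [J.symm z x x, hx, map_smul, J.symm (J.D x x z), J.symm z x x] at h
  rw [h]; module

theorem D_triple_of_cube (z : V) : J.D x x (J.D x z x) = c • J.D x z x := by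
  have h1 := J.jordan x x x z x
  have h2 := J.jordan x z x x x
  rw [hx, J.symm z x x] at h1
  rw [hx, J.symm (J.D x z x) x x] at h2
  simp only [map_smul, LinearMap.smul_apply] at h1 h2
  have h3 : (3 : ℂ) • (J.D x x (J.D x z x) - c • J.D x z x) = 0 := by
    linear_combination (norm := module) h1 - h2
  exact sub_eq_zero.mp ((smul_eq_zero.mp h3).resolve_left (by norm_num))

theorem triple_D_of_cube (z : V) : J.D x (J.D x x z) x = c • J.D x z x := by
  have h1 := J.jordan x x x z x
  rw [hx, J.symm z x x, D_triple_of_cube hx] at h1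
  simp only [map_smul, LinearMap.smul_apply] at h1
  linear_combination (norm := module) h1

theorem cubic_of_cube (z : V) :
    (2 : ℂ) • J.D x x (J.D x x (J.D x x z)) = (3 * c) • J.D x x (J.D x x z)
      - (c ^ 2) • J.D x x z := by
  have h := D_triple_of_cube hx (J.D x z x)
  rw [triple_triple_of_cube hx] at h
  simp only [map_smul, map_sub] at h
  linear_combination (norm := module) h

/-- If `{x x x} = c x` with `x ≠ 0` then `c` is real and positive: `D(x, x)` has eigenvalues
`0`, `c / 2`, `c`, so its trace, which is positive, is a nonnegative multiple of `c`. -/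
theorem pos_of_cube [FiniteDimensional ℂ V] (h0 : x ≠ 0) : 0 < c.re ∧ c.im = 0 := by
  obtain ⟨hre, him⟩ := J.pos x h0
  have hcub := cubic_of_cube hx
  set L : Module.End ℂ V := J.D x x with hL
  rcases eq_or_ne c 0 with rfl | hc
  · exfalso
    have hn : IsNilpotent L := ⟨3, by
      ext z
      have := hcub z
      simp only [mul_zero, zero_smul, ne_eq, OfNat.ofNat_ne_zero, not_false_eq_true, zero_pow,
        sub_zero, smul_eq_zero, false_or] at this
      simpa [pow_succ] using this⟩
    have := (LinearMap.isNilpotent_trace_of_isNilpotent hn).eq_zero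
    rw [this] at hre
    simp at hre
  · have hL3 : L * L * L = (3 * c / 2) • (L * L) - (c ^ 2 / 2) • L := by
      ext z
      have := hcub z
      simp only [Module.End.mul_apply, LinearMap.sub_apply, LinearMap.smul_apply]
      linear_combination (norm := module) (1 / 2 : ℂ) • this
    have hL4 : L * L * L * L = (3 * c / 2) • (L * L * L) - (c ^ 2 / 2) • (L * L) := by
      conv_lhs => rw [hL3]
      simp only [sub_mul, smul_mul_assoc]
    have id1 : IsIdempotentElem ((4 / c ^ 2) • (c • L - L * L)) := by
      have : (c • L - L * L) * (c • L - L * L)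
          = c ^ 2 • (L * L) - (2 * c) • (L * L * L) + L * L * L * L := by
        simp only [sub_mul, mul_sub, smul_mul_assoc, mul_smul_comm, mul_assoc]
        module
      rw [IsIdempotentElem, smul_mul_smul_comm, this, hL4, hL3]
      match_scalars <;> field_simp <;> ring
    have id2 : IsIdempotentElem ((1 / c ^ 2) • ((2 : ℂ) • (L * L) - c • L)) := by
      have : ((2 : ℂ) • (L * L) - c • L) * ((2 : ℂ) • (L * L) - c • L)
          = c ^ 2 • (L * L) - (4 * c) • (L * L * L) + (4 : ℂ) • (L * L * L * L) := by
        simp only [sub_mul, mul_sub, smul_mul_assoc, mul_smul_comm, mul_assoc]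
        module
      rw [IsIdempotentElem, smul_mul_smul_comm, this, hL4, hL3]
      match_scalars <;> field_simp <;> ring
    have t1 := (LinearMap.IsIdempotentElem.isProj_range _ id1).trace
    have t2 := (LinearMap.IsIdempotentElem.isProj_range _ id2).trace
    set n1 := Module.finrank ℂ (LinearMap.range ((4 / c ^ 2) • (c • L - L * L)))
    set n2 := Module.finrank ℂ (LinearMap.range ((1 / c ^ 2) • ((2 : ℂ) • (L * L) - c • L)))
    have hLs : L = (c / 2) • ((4 / c ^ 2) • (c • L - L * L))
        + c • ((1 / c ^ 2) • ((2 : ℂ) • (L * L) - c • L)) := by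
      match_scalars <;> field_simp <;> ring
    have ht : LinearMap.trace ℂ V L = ((n1 / 2 + n2 : ℝ) : ℂ) * c := by
      rw [hLs, map_add, map_smul _ (c / 2), map_smul _ c, t1, t2]
      simp only [smul_eq_mul]
      push_cast
      ring
    rw [ht] at hre him
    simp only [Complex.re_ofReal_mul, Complex.im_ofReal_mul] at hre him
    have hq : (0 : ℝ) ≤ n1 / 2 + n2 := by positivity
    rcases hq.eq_or_lt with h | h
    · rw [← h] at hre; simp at hre
    · exact ⟨by by_contra hcon; nlinarith, by simpa [h.ne'] using him⟩

end Cube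

theorem isTripotent_iff {e : V} : J.IsTripotent e ↔ J.D e e e = (2 : ℂ) • e := by
  unfold IsTripotent
  constructor
  · intro h
    linear_combination (norm := module) (2 : ℂ) • h
  · intro h
    rw [h]; module

theorem mem_peirce {e z : V} {a : ℂ} : z ∈ J.peirce e a ↔ J.D e e z = a • z :=
  Module.End.mem_eigenspace_iff

/-- The Peirce rule `{V_a V_b V_c} ⊆ V_{a - b + c}`. -/
theorem peirce_rule {e x y z : V} {a b c : ℂ} (hb : starRingEnd ℂ b = b) (hx : x ∈ J.peirce e a)
    (hy : y ∈ J.peirce e b) (hz : z ∈ J.peirce e c) : J.D x y z ∈ J.peirce e (a - b + c) := by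
  rw [mem_peirce] at *
  rw [J.jordan, J.symm y e e, hx, hy, hz]
  simp only [map_smul, LinearMap.smul_apply, map_smulₛₗ, hb]
  module

section Tripotent

variable {J} {e : V} (he : J.IsTripotent e)
include he

theorem tripotent_cubic (z : V) :
    J.D e e (J.D e e (J.D e e z)) = (3 : ℂ) • J.D e e (J.D e e z) - (2 : ℂ) • J.D e e z := by
  have := cubic_of_cube (J.isTripotent_iff.mp he) z
  linear_combination (norm := module) (1 / 2 : ℂ) • this

theorem self_mem_peirce : e ∈ J.peirce e 2 := J.mem_peirce.mpr (J.isTripotent_iff.mp he)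

theorem triple_mem_peirce_two (z : V) : J.D e z e ∈ J.peirce e 2 :=
  J.mem_peirce.mpr (D_triple_of_cube (J.isTripotent_iff.mp he) z)

theorem triple_triple_of_mem_two {z : V} (hz : z ∈ J.peirce e 2) :
    J.D e (J.D e z e) e = (4 : ℂ) • z := by
  rw [mem_peirce] at hz
  rw [triple_triple_of_cube (J.isTripotent_iff.mp he), hz, map_smul, hz]
  module

/-- A Peirce space for a number other than `0`, `1`, `2` vanishes. -/
theorem eq_zero_of_mem_peirce {z : V} {a : ℂ} (h0 : a ≠ 0) (h1 : a ≠ 1) (h2 : a ≠ 2)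
    (hz : z ∈ J.peirce e a) : z = 0 := by
  rw [mem_peirce] at hz
  have h := tripotent_cubic he z
  simp only [hz, map_smul] at h
  have h3 : (a * (a - 1) * (a - 2)) • z = 0 := by
    linear_combination (norm := module) h
  refine (smul_eq_zero.mp h3).resolve_left ?_
  exact mul_ne_zero (mul_ne_zero h0 (sub_ne_zero.mpr h1)) (sub_ne_zero.mpr h2)

/-- The Peirce decomposition of a vector. -/
theorem exists_peirce_decomp (z : V) : ∃ z₀ ∈ J.peirce e 0, ∃ z₁ ∈ J.peirce e 1,
    ∃ z₂ ∈ J.peirce e 2, z = z₀ + z₁ + z₂ := by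
  have h := tripotent_cubic he z
  refine ⟨z - (3 / 2 : ℂ) • J.D e e z + (1 / 2 : ℂ) • J.D e e (J.D e e z), ?_,
    (2 : ℂ) • J.D e e z - J.D e e (J.D e e z), ?_,
    (1 / 2 : ℂ) • J.D e e (J.D e e z) - (1 / 2 : ℂ) • J.D e e z, ?_, by module⟩
  all_goals
    rw [mem_peirce]
    simp only [map_add, map_sub, map_smul, h]
    module

/-- `{V₀(e) V₂(e) V₂(e)} = 0`. -/
theorem D_zero_two_two {y w : V} (hy : y ∈ J.peirce e 0) (hw : w ∈ J.peirce e 2) :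
    J.D y e w = 0 := by
  have hw' : w = J.D e ((1 / 4 : ℂ) • J.D e w e) e := by
    simp only [map_smulₛₗ, LinearMap.smul_apply, triple_triple_of_mem_two he hw, smul_smul]
    norm_num [map_ofNat]
  have hw2 : (1 / 4 : ℂ) • J.D e w e ∈ J.peirce e 2 :=
    Submodule.smul_mem _ _ (triple_mem_peirce_two he w)
  set w' := (1 / 4 : ℂ) • J.D e w e
  have h4 : J.D w' y e = 0 := by
    have := J.peirce_rule (by simp) hw2 hy (self_mem_peirce he)
    exact eq_zero_of_mem_peirce he (by norm_num) (by norm_num) (by norm_num) this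
  have hye : J.D y e e = 0 := by
    rw [J.symm y e e]
    simpa using J.mem_peirce.mp hy
  rw [hw', J.jordan, h4, hye]
  simp

theorem D_tripotent_zero {y : V} (hy : y ∈ J.peirce e 0) : J.D e y = 0 := by
  ext z
  obtain ⟨z₀, h0, z₁, h1, z₂, h2, rfl⟩ := exists_peirce_decomp he z
  have e1 : J.D e y z₁ = 0 := eq_zero_of_mem_peirce he (by norm_num) (by norm_num) (by norm_num)
    (J.peirce_rule (by simp) (self_mem_peirce he) hy h1)
  have e2 : J.D e y z₂ = 0 := eq_zero_of_mem_peirce he (by norm_num) (by norm_num) (by norm_num)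
    (J.peirce_rule (by simp) (self_mem_peirce he) hy h2)
  have e0 : J.D e y z₀ = 0 := by
    have hm := J.peirce_rule (by simp) (self_mem_peirce he) hy h0
    by_contra hne
    apply J.herm_self_ne_zero hne
    rw [herm_adjoint, D_zero_two_two he hy (by simpa using hm), herm_zero_right]
  simp [e0, e1, e2]

/-- `D(V₂(e), V₀(e)) = 0`. -/
theorem D_two_zero {x y : V} (hx : x ∈ J.peirce e 2) (hy : y ∈ J.peirce e 0) : J.D x y = 0 := by
  ext z
  have h := J.jordan e ((1 / 4 : ℂ) • J.D e x e) e y z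
  have hx' : x = J.D e ((1 / 4 : ℂ) • J.D e x e) e := by
    simp only [map_smulₛₗ, LinearMap.smul_apply, triple_triple_of_mem_two he hx, smul_smul]
    norm_num [map_ofNat]
  have hx2 : (1 / 4 : ℂ) • J.D e x e ∈ J.peirce e 2 :=
    Submodule.smul_mem _ _ (triple_mem_peirce_two he x)
  rw [← hx', D_tripotent_zero he hy, D_zero_two_two he hy hx2] at h
  simpa using h.symm

theorem D_zero_two {x y : V} (hx : x ∈ J.peirce e 0) (hy : y ∈ J.peirce e 2) : J.D x y = 0 :=
  J.D_eq_zero_of_swap (D_two_zero he hy hx)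

end Tripotent

/-- Peirce spaces with different real eigenvalues are orthogonal for the trace form. -/
theorem herm_peirce {e x y : V} {a b : ℂ} (hb : starRingEnd ℂ b = b) (hab : a ≠ b)
    (hx : x ∈ J.peirce e a) (hy : y ∈ J.peirce e b) : J.herm x y = 0 := by
  have h := J.herm_adjoint e e x y
  rw [J.mem_peirce.mp hx, J.mem_peirce.mp hy, herm_smul_left, herm_smul_right, hb] at h
  have h2 : (a - b) * J.herm x y = 0 := by linear_combination h
  exact (mul_eq_zero.mp h2).resolve_left (sub_ne_zero.mpr hab)

end Algebra

/-! ### The real form of the Peirce space `V₂(e)` -/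

section RealForm

variable {V : Type*} [AddCommGroup V] [Module ℂ V] (J : PosHermJordanTriple V)

/-- The real form `{z ∈ V₂(e) : ½ {e z e} = z}` of the Peirce space `V₂(e)`; it is a formally
real Jordan algebra with unit `e`. -/
def realForm (e : V) : Submodule ℝ V where
  carrier := {z | J.D e e z = (2 : ℂ) • z ∧ J.D e z e = (2 : ℂ) • z}
  add_mem' := by
    rintro a b ⟨ha, ha'⟩ ⟨hb, hb'⟩
    simp only [Set.mem_ofPred_eq, map_add, LinearMap.add_apply, ha, ha', hb, hb', smul_add,
      and_self]
  zero_mem' := by simp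
  smul_mem' := by
    rintro c a ⟨ha, ha'⟩
    simp only [Set.mem_ofPred_eq, ← Complex.coe_smul, map_smul, map_smulₛₗ, LinearMap.smul_apply,
      ha, ha', Complex.conj_ofReal, smul_comm (c : ℂ) (2 : ℂ), and_self]

variable {J} {e : V}

section Closure

variable (he : J.IsTripotent e) {x y v : V}
include he

theorem self_mem_realForm : e ∈ J.realForm e :=
  ⟨J.isTripotent_iff.mp he, J.isTripotent_iff.mp he⟩

omit he in
/-- Preparation for `realForm_mul`: the Jordan identity first makes `{e x v}` symmetric in `x` and
`v`, and then determines the conjugates of `{e x v}` and `{v e x}`. -/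
theorem realForm_swap (hx : x ∈ J.realForm e) (hv : v ∈ J.realForm e) :
    J.D e v x = J.D e x v ∧ J.D e (J.D v e x) e = (2 : ℂ) • J.D e x v ∧
      J.D e (J.D e x v) e = (4 : ℂ) • J.D e x v - (2 : ℂ) • J.D v e x := by
  obtain ⟨hx1, hx2⟩ := hx
  obtain ⟨hv1, hv2⟩ := hv
  have key : ∀ a b : V, J.D e e a = (2 : ℂ) • a → J.D e a e = (2 : ℂ) • a →
      J.D e b e = (2 : ℂ) • b → J.D e (J.D b e a) e
        = (4 : ℂ) • J.D e b a - (2 : ℂ) • J.D e a b := by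
    intro a b ha ha' hb
    have h := J.jordan_middle e a e b e
    rw [ha', hb] at h
    simp only [map_smul, LinearMap.smul_apply, J.symm a b e] at h
    rw [h]; module
  have h1 := key x v hx1 hx2 hv2
  have h2 := key v x hv1 hv2 hx2
  rw [J.symm x e v, h1] at h2
  have h3 : (6 : ℂ) • (J.D e v x - J.D e x v) = 0 := by
    linear_combination (norm := module) h2
  have h4 := sub_eq_zero.mp ((smul_eq_zero.mp h3).resolve_left (by norm_num))
  refine ⟨h4, by rw [h1, h4]; module, ?_⟩
  have h := J.jordan_middle x e e v e
  rw [J.symm x e e, hx1, hv2] at h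
  simp only [map_smul, LinearMap.smul_apply, J.symm x v e, J.symm x e v, J.symm v x e, h4] at h
  rw [h]
  module

/-- The Jordan product `{x e y}` of the real form, and the fact that it equals `{e x y}`. -/
theorem realForm_mul (hx : x ∈ J.realForm e) (hv : v ∈ J.realForm e) :
    J.D e x v = J.D v e x ∧ J.D v e x ∈ J.realForm e := by
  obtain ⟨-, h1, h2⟩ := realForm_swap hx hv
  have m2 : J.D v e x ∈ J.peirce e 2 := by
    have := J.peirce_rule (map_ofNat _ 2) (J.mem_peirce.mpr hv.1) (self_mem_peirce he)
      (J.mem_peirce.mpr hx.1)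
    simpa using this
  have h3 := triple_triple_of_mem_two he m2
  rw [h1] at h3
  simp only [map_smulₛₗ, LinearMap.smul_apply, h2, map_ofNat] at h3
  have h4 : (8 : ℂ) • (J.D e x v - J.D v e x) = 0 := by
    linear_combination (norm := module) h3
  have h5 := sub_eq_zero.mp ((smul_eq_zero.mp h4).resolve_left (by norm_num))
  exact ⟨h5, J.mem_peirce.mp m2, by rw [h1, h5]⟩

/-- The real form is closed under the triple product. -/
theorem realForm_triple (hx : x ∈ J.realForm e) (hy : y ∈ J.realForm e) (hv : v ∈ J.realForm e) :
    J.D x y v ∈ J.realForm e := by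
  have h := J.jordan v e x y e
  rw [J.symm y v e, (realForm_mul he hv hy).1, J.symm v e e, hv.1, J.symm x y e,
    (realForm_mul he hy hx).1, J.symm (J.D v e x) y e,
    (realForm_mul he hy (realForm_mul he hx hv).2).1] at h
  have hsum : (2 : ℝ) • J.D x y v
      = J.D v e (J.D x e y) - J.D (J.D v e x) e y + J.D x (J.D y e v) e := by
    rw [h]
    simp only [map_smul]
    rw [← Complex.coe_smul]
    push_cast
    module
  have hmem : (2 : ℝ) • J.D x y v ∈ J.realForm e := by
    rw [hsum, J.symm x (J.D y e v) e,
      (realForm_mul he (realForm_mul he hv hy).2 hx).1]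
    exact add_mem (sub_mem (realForm_mul he (realForm_mul he hy hx).2 hv).2
      (realForm_mul he hy (realForm_mul he hx hv).2).2)
      (realForm_mul he (realForm_mul he hv hy).2 hx).2
  have := (J.realForm e).smul_mem (1 / 2 : ℝ) hmem
  rwa [smul_smul, show (1 / 2 * 2 : ℝ) = 1 by norm_num, one_smul] at this

end Closure

/-- The splitting `e = p + q` of a tripotent `e` by a tripotent `f` in its real form:
`p = f²` lies in `V₂(f)` and `q = e - f²` in `V₀(f)`. -/
theorem split_of_realForm {f : V} (he : J.IsTripotent e) (hf : J.IsTripotent f)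
    (hfe : f ∈ J.realForm e) :
    J.D f e f = J.D f f e ∧ J.D f f (J.D f f e) = (2 : ℂ) • J.D f f e := by
  have hf3 := J.isTripotent_iff.mp hf
  have hg : J.D f f e = J.D f e f := by rw [J.symm f f e, (realForm_mul he hfe hfe).1]
  refine ⟨hg.symm, ?_⟩
  have h1 := J.jordan_middle f e f f f
  rw [hf3, ← hg, J.symm (J.D f f e) f f] at h1
  have h2 := triple_D_of_cube hf3 e
  rw [h1, ← hg] at h2
  simp only [map_smul, ← hg] at h2
  linear_combination (norm := module) (1 / 2 : ℂ) • h2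

/-- A tripotent whose real form contains a nonzero tripotent `f` other than `±e` is not primitive:
either `e = f² + (e - f²)` or, if `f² = e`, `e = (e + f) / 2 + (e - f) / 2` is a decomposition into
orthogonal nonzero tripotents. -/
theorem eq_or_eq_neg_of_isPrimitive {f : V} (he : J.IsPrimitive e) (hf : J.IsTripotent f)
    (hf0 : f ≠ 0) (hfe : f ∈ J.realForm e) : f = e ∨ f = -e := by
  obtain ⟨he1, he0, hprim⟩ := he
  have he3 := J.isTripotent_iff.mp he1
  have hf3 := J.isTripotent_iff.mp hf
  obtain ⟨hg, hgg⟩ := split_of_realForm he1 hf hfe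
  set p := (1 / 2 : ℂ) • J.D f f e with hp
  set q := e - p with hq
  have hp2 : p ∈ J.peirce f 2 := by
    rw [mem_peirce, hp, map_smul, hgg, smul_comm]
  have hq0 : q ∈ J.peirce f 0 := by
    rw [mem_peirce, hq, map_sub, hp, map_smul, hgg]; module
  have hpq : J.D p q = 0 := D_two_zero hf hp2 hq0
  have hqp : J.D q p = 0 := D_zero_two hf hq0 hp2
  have hepq : e = p + q := by rw [hq]; abel
  have hppq : J.D p p q = 0 := by rw [J.symm, hqp]; rfl
  have hqqp : J.D q q p = 0 := by rw [J.symm, hpq]; rfl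
  have hcube : J.D p p p + J.D q q q = (2 : ℂ) • p + (2 : ℂ) • q := by
    have h := he3
    rw [hepq] at h
    simp only [map_add, LinearMap.add_apply, hpq, hqp, hppq, hqqp, LinearMap.zero_apply,
      smul_add] at h
    linear_combination (norm := module) h
  have hppp : J.D p p p ∈ J.peirce f 2 := by
    have := J.peirce_rule (map_ofNat _ 2) hp2 hp2 hp2
    simpa using this
  have hqqq : J.D q q q ∈ J.peirce f 0 := by
    have := J.peirce_rule (by simp) hq0 hq0 hq0
    simpa using this
  have hd : J.D p p p - (2 : ℂ) • p = 0 := by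
    have h1 : J.D p p p - (2 : ℂ) • p ∈ J.peirce f 2 :=
      sub_mem hppp (Submodule.smul_mem _ _ hp2)
    have h2 : J.D p p p - (2 : ℂ) • p ∈ J.peirce f 0 := by
      have : J.D p p p - (2 : ℂ) • p = (2 : ℂ) • q - J.D q q q := by
        linear_combination (norm := module) hcube
      rw [this]
      exact sub_mem (Submodule.smul_mem _ _ hq0) hqqq
    rw [mem_peirce] at h1 h2
    rw [h1, zero_smul] at h2
    exact (smul_eq_zero.mp h2).resolve_left two_ne_zero
  have hpt : J.IsTripotent p := J.isTripotent_iff.mpr (sub_eq_zero.mp hd)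
  have hqt : J.IsTripotent q := J.isTripotent_iff.mpr (by
    linear_combination (norm := module) hcube - hd)
  by_cases hp0 : p = 0
  · -- then `e ∈ V₀(f)`, so `f = ½ {e e f} = 0`
    exfalso
    rw [hp0, zero_add] at hepq
    have h := D_zero_two hf (hepq ▸ hq0) (self_mem_peirce hf)
    have h2 := hfe.1
    rw [J.symm, J.D_eq_zero_of_swap h] at h2
    exact hf0 ((smul_eq_zero.mp h2.symm).resolve_left two_ne_zero)
  by_cases hq0' : q = 0
  · -- then `f² = e`, and `(e ± f) / 2` are orthogonal tripotents with sum `e`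
    rw [hq0', add_zero] at hepq
    have hffe : J.D f f e = (2 : ℂ) • e := by
      rw [hepq]; exact J.mem_peirce.mp hp2
    have hfef : J.D f e f = (2 : ℂ) • e := by rw [hg, hffe]
    have heef := hfe.1
    have hefe := hfe.2
    have hfee : J.D f e e = (2 : ℂ) • f := by rw [J.symm, heef]
    have heff : J.D e f f = (2 : ℂ) • e := by rw [J.symm, hffe]
    by_contra hcon
    push Not at hcon
    set s := (1 / 2 : ℂ) • (e + f) with hs
    set d := (1 / 2 : ℂ) • (e - f) with hdd
    have hst : J.IsTripotent s := by
      rw [isTripotent_iff, hs]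
      simp only [map_smul, map_smulₛₗ, map_add, LinearMap.add_apply, LinearMap.smul_apply, he3,
        hf3, hffe, hfef, heef, hefe, hfee, heff, map_div₀, map_one, map_ofNat]
      module
    have hdt : J.IsTripotent d := by
      rw [isTripotent_iff, hdd]
      simp only [map_smul, map_smulₛₗ, map_sub, LinearMap.sub_apply, LinearMap.smul_apply, he3,
        hf3, hffe, hfef, heef, hefe, hfee, heff, map_div₀, map_one, map_ofNat]
      module
    have hd0 : d ∈ J.peirce s 0 := by
      rw [mem_peirce, hs, hdd]
      simp only [map_smul, map_smulₛₗ, map_add, map_sub, LinearMap.add_apply,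
        LinearMap.smul_apply, he3, hf3, hffe, hfef, heef, hefe, hfee, heff, map_div₀, map_one,
        map_ofNat]
      module
    refine hprim ⟨s, d, hst, hdt, ?_, ?_, D_two_zero hst (self_mem_peirce hst) hd0, ?_⟩
    · intro h
      apply hcon.2
      have := (smul_eq_zero.mp h).resolve_left (by norm_num)
      rw [eq_neg_iff_add_eq_zero, add_comm]; exact this
    · intro h
      apply hcon.1
      have := (smul_eq_zero.mp h).resolve_left (by norm_num)
      exact (sub_eq_zero.mp this).symm
    · rw [hs, hdd]; module
  · exact absurd ⟨p, q, hpt, hqt, hp0, hq0', hpq, hepq⟩ hprim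

end RealForm

/-! ### Continuity of the triple product and of the trace form -/

section Continuous

variable {V : Type*} [NormedAddCommGroup V] [NormedSpace ℂ V] [FiniteDimensional ℂ V]
  (J : PosHermJordanTriple V)

/-- The triple product as a continuous real trilinear map. -/
noncomputable def tripleL : V →L[ℝ] V →L[ℝ] V →L[ℝ] V :=
  (LinearMap.mk₂ ℝ (fun x y => ((J.D x y).restrictScalars ℝ).toContinuousLinearMap)
    (fun _ _ _ => by ext; simp)
    (fun c _ _ => by ext; simp [← Complex.coe_smul])
    (fun _ _ _ => by ext; simp)
    (fun c _ _ => by ext; simp [← Complex.coe_smul])).toContinuousBilinearMap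

/-- The trace form as a continuous real bilinear map. -/
noncomputable def hermL : V →L[ℝ] V →L[ℝ] ℂ :=
  (LinearMap.mk₂ ℝ (fun x y => J.herm x y)
    (fun _ _ _ => J.herm_add_left _ _ _)
    (fun c _ _ => by simp [← Complex.coe_smul, herm_smul_left])
    (fun _ _ _ => J.herm_add_right _ _ _)
    (fun c _ _ => by simp [← Complex.coe_smul, herm_smul_right])).toContinuousBilinearMap

@[simp] theorem hermL_apply (x y : V) : J.hermL x y = J.herm x y := rfl

end Continuous

/-! ### Primitive tripotents: `V₂(e) = ℂ e` -/

/-- First and second order conditions for a quartic polynomial with a minimum at the origin. -/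
theorem quartic_nonneg {c₁ c₂ c₃ c₄ : ℝ}
    (h : ∀ t : ℝ, 0 ≤ c₁ * t + c₂ * t ^ 2 + c₃ * t ^ 3 + c₄ * t ^ 4) : c₁ = 0 ∧ 0 ≤ c₂ := by
  have h1 : c₁ = 0 := by
    have hmin : IsLocalMin (fun t : ℝ => c₁ * t + c₂ * t ^ 2 + c₃ * t ^ 3 + c₄ * t ^ 4) 0 :=
      Filter.Eventually.of_forall fun t => by simpa using h t
    have hd : HasDerivAt (fun t : ℝ => c₁ * t + c₂ * t ^ 2 + c₃ * t ^ 3 + c₄ * t ^ 4) c₁ 0 := by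
      have := ((((hasDerivAt_id (0 : ℝ)).const_mul c₁).add
        (((hasDerivAt_id (0 : ℝ)).pow 2).const_mul c₂)).add
        (((hasDerivAt_id (0 : ℝ)).pow 3).const_mul c₃)).add
        (((hasDerivAt_id (0 : ℝ)).pow 4).const_mul c₄)
      exact this.congr_deriv (by simp)
    exact hmin.hasDerivAt_eq_zero hd
  refine ⟨h1, ?_⟩
  by_contra hneg
  push Not at hneg
  have hc : 0 < |c₄| + 1 := by positivity
  have hs : 0 < -c₂ / (2 * (|c₄| + 1)) := div_pos (by linarith) (by linarith)
  set t := Real.sqrt (-c₂ / (2 * (|c₄| + 1))) with ht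
  have ht2 : t ^ 2 = -c₂ / (2 * (|c₄| + 1)) := Real.sq_sqrt hs.le
  have hp := h t
  have hm := h (-t)
  have h3 : 0 ≤ t ^ 2 * (c₂ + c₄ * t ^ 2) := by nlinarith
  have h4 : 0 ≤ c₂ + c₄ * t ^ 2 := by
    by_contra hcon
    push Not at hcon
    have : 0 < t ^ 2 := by rw [ht2]; exact hs
    nlinarith
  have h5 : c₄ * t ^ 2 ≤ |c₄| * t ^ 2 := mul_le_mul_of_nonneg_right (le_abs_self _) (sq_nonneg _)
  have h6 : (|c₄| + 1) * t ^ 2 = -c₂ / 2 := by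
    rw [ht2]; field_simp
  nlinarith [sq_nonneg t]

section Quartic

variable {V : Type*} [AddCommGroup V] [Module ℂ V] (J : PosHermJordanTriple V)

/-- The quartic form `({x x x} | x)`. -/
noncomputable def quartic (x : V) : ℝ := (J.herm (J.D x x x) x).re

theorem re_herm_comm (x y : V) : (J.herm x y).re = (J.herm y x).re := by
  rw [← J.herm_conj x y, Complex.conj_re]

theorem herm_self_add_smul (x u : V) (t : ℝ) : (J.herm (x + t • u) (x + t • u)).re
    = (J.herm x x).re + 2 * (J.herm x u).re * t + (J.herm u u).re * t ^ 2 := by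
  simp only [← Complex.coe_smul, herm_add_left, herm_add_right, herm_smul_left, herm_smul_right,
    Complex.add_re, Complex.conj_ofReal, Complex.re_ofReal_mul, J.re_herm_comm u x]
  ring

theorem quartic_smul (x : V) (t : ℝ) : J.quartic (t • x) = t ^ 4 * J.quartic x := by
  simp only [quartic, ← Complex.coe_smul, map_smul, map_smulₛₗ, LinearMap.smul_apply,
    herm_smul_left, herm_smul_right, Complex.conj_ofReal, Complex.re_ofReal_mul]
  ring

theorem quartic_add_smul (x u : V) : ∃ c₃ : ℝ, ∀ t : ℝ, J.quartic (x + t • u)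
    = J.quartic x + 4 * (J.herm (J.D x x x) u).re * t
      + (4 * (J.herm (J.D u u x) x).re + (J.herm (J.D u x u) x).re
        + (J.herm (J.D x u x) u).re) * t ^ 2 + c₃ * t ^ 3 + J.quartic u * t ^ 4 := by
  have e1 : (J.herm (J.D u x x) x).re = (J.herm (J.D x x x) u).re := by
    rw [J.symm u x x, herm_adjoint, re_herm_comm]
  have e2 : (J.herm (J.D x u x) x).re = (J.herm (J.D x x x) u).re := by
    rw [herm_adjoint, re_herm_comm, J.symm u x x, herm_adjoint, re_herm_comm]
  have e3 : (J.herm (J.D x u u) x).re = (J.herm (J.D u u x) x).re := by rw [J.symm x u u]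
  have e4 : (J.herm (J.D u x x) u).re = (J.herm (J.D u u x) x).re := by
    rw [herm_adjoint, J.symm x u u, re_herm_comm]
  have e5 : (J.herm (J.D x x u) u).re = (J.herm (J.D u u x) x).re := by
    rw [J.symm x x u, e4]
  have e6 : (J.herm (J.D x x u) x).re = (J.herm (J.D x x x) u).re := by
    rw [herm_adjoint, re_herm_comm]
  refine ⟨(J.herm (J.D u u u) x).re + (J.herm (J.D u u x) u).re + (J.herm (J.D u x u) u).re
    + (J.herm (J.D x u u) u).re, fun t => ?_⟩
  simp only [quartic, ← Complex.coe_smul, map_add, LinearMap.add_apply, map_smul, map_smulₛₗ,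
    LinearMap.smul_apply, herm_add_left, herm_add_right,
    herm_smul_left, herm_smul_right, Complex.conj_ofReal, Complex.add_re, Complex.re_ofReal_mul,
    e1, e2, e3, e4, e5, e6]
  ring

end Quartic

section Primitive

variable {V : Type*} [NormedAddCommGroup V] [NormedSpace ℂ V] [FiniteDimensional ℂ V]
  {J : PosHermJordanTriple V}

/-- On a nonzero real subspace the quartic form, normalised by the square of the trace form,
attains its maximum. -/
theorem exists_max_quartic (A : Submodule ℝ V) (hA : ∃ a ∈ A, a ≠ 0) :
    ∃ x ∈ A, x ≠ 0 ∧ ∃ m : ℝ, J.quartic x = m * (J.herm x x).re ^ 2 ∧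
      ∀ y ∈ A, J.quartic y ≤ m * (J.herm y y).re ^ 2 := by
  have : ProperSpace V := FiniteDimensional.proper ℂ V
  have hK : IsCompact (Metric.sphere (0 : V) 1 ∩ A) :=
    (isCompact_sphere 0 1).inter_right A.closed_of_finiteDimensional
  have hunit : ∀ a : V, a ≠ 0 → ‖(‖a‖⁻¹ : ℝ) • a‖ = 1 := fun a ha => by
    rw [norm_smul, norm_inv, norm_norm, inv_mul_cancel₀ (norm_ne_zero_iff.mpr ha)]
  obtain ⟨a, haA, ha0⟩ := hA
  have hne : (Metric.sphere (0 : V) 1 ∩ A).Nonempty :=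
    ⟨(‖a‖⁻¹ : ℝ) • a, by simpa using hunit a ha0, A.smul_mem _ haA⟩
  have hc1 : Continuous fun x : V => (J.herm x x).re :=
    Complex.continuous_re.comp
      ((J.hermL.continuous.clm_apply continuous_id : Continuous fun x => J.hermL x x))
  have hc2 : Continuous fun x : V => J.quartic x := by
    have h : Continuous fun x : V => J.tripleL x x x :=
      (J.tripleL.continuous.clm_apply continuous_id).clm_apply continuous_id
    exact Complex.continuous_re.comp ((J.hermL.continuous.comp h).clm_apply continuous_id)
  have hcont : ContinuousOn (fun x : V => J.quartic x / (J.herm x x).re ^ 2)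
      (Metric.sphere (0 : V) 1 ∩ A) := by
    refine hc2.continuousOn.div (hc1.pow 2).continuousOn fun x hx => ?_
    have : x ≠ 0 := by
      rintro rfl
      simp at hx
    exact pow_ne_zero _ (J.herm_self_pos this).ne'
  obtain ⟨x, ⟨hx1, hxA⟩, hmax⟩ := hK.exists_isMaxOn hne hcont
  have hx0 : x ≠ 0 := by
    rintro rfl
    simp at hx1
  refine ⟨x, hxA, hx0, J.quartic x / (J.herm x x).re ^ 2, ?_, fun y hy => ?_⟩
  · have := (J.herm_self_pos hx0).ne'
    field_simp
  · rcases eq_or_ne y 0 with rfl | hy0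
    · simp [quartic]
    have h := hmax (a := (‖y‖⁻¹ : ℝ) • y) ⟨by simpa using hunit y hy0, A.smul_mem _ hy⟩
    have hn : 0 < ‖y‖⁻¹ := inv_pos.mpr (norm_pos_iff.mpr hy0)
    have hp := J.herm_self_pos hy0
    have hherm : (J.herm ((‖y‖⁻¹ : ℝ) • y) ((‖y‖⁻¹ : ℝ) • y)).re
        = ‖y‖⁻¹ ^ 2 * (J.herm y y).re := by
      simp only [← Complex.coe_smul, herm_smul_left, herm_smul_right, Complex.conj_ofReal,
        Complex.re_ofReal_mul]
      ring
    simp only [Set.mem_ofPred_eq, quartic_smul, hherm] at h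
    rw [show ‖y‖⁻¹ ^ 4 * J.quartic y / (‖y‖⁻¹ ^ 2 * (J.herm y y).re) ^ 2
      = J.quartic y / (J.herm y y).re ^ 2 by field_simp] at h
    exact (div_le_iff₀ (by positivity)).mp h

/-- A real subspace closed under the triple product contains an element with `{x x x} = c x` at
which the normalised quartic form is maximal. -/
theorem exists_cube_of_max (A : Submodule ℝ V) (hA : ∃ a ∈ A, a ≠ 0)
    (hcl : ∀ x ∈ A, J.D x x x ∈ A) :
    ∃ x ∈ A, x ≠ 0 ∧ ∃ c : ℝ, J.D x x x = (c : ℂ) • x ∧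
      ∀ y ∈ A, J.quartic y * (J.herm x x).re ≤ c * (J.herm y y).re ^ 2 := by
  obtain ⟨x, hxA, hx0, m, hxm, hmax⟩ := exists_max_quartic (J := J) A hA
  have hpos := J.herm_self_pos hx0
  set n := (J.herm x x).re with hn
  refine ⟨x, hxA, hx0, m * n, ?_, fun y hy => by nlinarith [hmax y hy]⟩
  set u := J.D x x x - ((m * n : ℝ) : ℂ) • x with hu
  have huA : u ∈ A := by
    rw [hu, Complex.coe_smul]
    exact A.sub_mem (hcl x hxA) (A.smul_mem _ hxA)
  obtain ⟨c₃, hq⟩ := J.quartic_add_smul x u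
  have hpoly := fun t : ℝ => hmax (x + t • u) (A.add_mem hxA (A.smul_mem t huA))
  simp only [hq, herm_self_add_smul, ← hn, hxm] at hpoly
  obtain ⟨h1, -⟩ := quartic_nonneg (c₁ := m * (4 * n * (J.herm x u).re)
      - 4 * (J.herm (J.D x x x) u).re)
    (c₂ := m * (4 * (J.herm x u).re ^ 2 + 2 * n * (J.herm u u).re)
      - (4 * (J.herm (J.D u u x) x).re + (J.herm (J.D u x u) x).re + (J.herm (J.D x u x) u).re))
    (c₃ := m * (4 * (J.herm x u).re * (J.herm u u).re) - c₃)
    (c₄ := m * (J.herm u u).re ^ 2 - J.quartic u) (fun t => by linarith [hpoly t])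
  have h2 : (J.herm u u).re = 0 := by
    have : J.herm u u = J.herm (J.D x x x) u - ((m * n : ℝ) : ℂ) * J.herm x u := by
      conv_lhs => rw [hu]
      rw [← hu, herm_sub_left, herm_smul_left]
    rw [this, Complex.sub_re, Complex.re_ofReal_mul]
    linarith
  by_contra hcon
  exact (J.herm_self_pos (sub_ne_zero.mpr hcon)).ne' h2

omit [FiniteDimensional ℂ V] in
theorem isTripotent_of_cube {x : V} {c : ℝ} (hc : 0 < c) (hx : J.D x x x = (c : ℂ) • x) :
    J.IsTripotent (((Real.sqrt (2 / c) : ℝ) : ℂ) • x) := by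
  rw [isTripotent_iff]
  simp only [map_smul, map_smulₛₗ, LinearMap.smul_apply, hx, Complex.conj_ofReal, smul_smul]
  congr 1
  have h : Real.sqrt (2 / c) * Real.sqrt (2 / c) = 2 / c := Real.mul_self_sqrt (by positivity)
  have h2 : Real.sqrt (2 / c) * (Real.sqrt (2 / c) * Real.sqrt (2 / c) * c)
      = 2 * Real.sqrt (2 / c) := by
    rw [h]; field_simp
  exact_mod_cast h2

/-- The real form of a primitive tripotent is a line: otherwise the maximum of the normalised
quartic form over it yields a tripotent different from `±e`, because `e` itself fails the
second-order condition at a maximum. -/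
theorem realForm_of_isPrimitive {e : V} (he : J.IsPrimitive e) {a : V} (ha : a ∈ J.realForm e) :
    ∃ t : ℝ, a = t • e := by
  by_contra hcon
  push Not at hcon
  obtain ⟨he1, he0, -⟩ := id he
  have he3 := J.isTripotent_iff.mp he1
  have hepos := J.herm_self_pos he0
  have heA := self_mem_realForm he1
  obtain ⟨x, hxA, hx0, c, hxc, hmax⟩ := exists_cube_of_max (J := J) (J.realForm e) ⟨e, heA, he0⟩
    (fun x hx => realForm_triple he1 hx hx hx)
  have hc : 0 < c := by simpa using (pos_of_cube hxc hx0).1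
  have hsq : 0 < Real.sqrt (2 / c) := Real.sqrt_pos.mpr (by positivity)
  have hfA : ((Real.sqrt (2 / c) : ℝ) : ℂ) • x ∈ J.realForm e := by
    rw [Complex.coe_smul]
    exact (J.realForm e).smul_mem _ hxA
  have hxe : ∃ r : ℝ, x = r • e := by
    rcases eq_or_eq_neg_of_isPrimitive he (isTripotent_of_cube hc hxc)
      (smul_ne_zero (by exact_mod_cast hsq.ne') hx0) hfA with h | h
    · exact ⟨(Real.sqrt (2 / c))⁻¹, by
        rw [← h, Complex.coe_smul, smul_smul, inv_mul_cancel₀ hsq.ne', one_smul]⟩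
    · exact ⟨-(Real.sqrt (2 / c))⁻¹, by
        rw [neg_smul, ← smul_neg, ← h, Complex.coe_smul, smul_smul, inv_mul_cancel₀ hsq.ne',
          one_smul]⟩
  obtain ⟨r, hr⟩ := hxe
  have hr0 : r ≠ 0 := by
    rintro rfl
    exact hx0 (by simpa using hr)
  -- the component `u` of `a` orthogonal to `e`
  set n := (J.herm e e).re with hn
  set u := a - ((J.herm e a).re / n) • e with hu
  have huA : u ∈ J.realForm e := sub_mem ha ((J.realForm e).smul_mem _ heA)
  have hu0 : u ≠ 0 := sub_ne_zero.mpr (hcon _)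
  have hue : (J.herm e u).re = 0 := by
    rw [hu, herm_sub_right, ← Complex.coe_smul, herm_smul_right, Complex.conj_ofReal,
      Complex.sub_re, Complex.re_ofReal_mul, ← hn]
    field_simp
    ring
  have hk := J.herm_self_pos hu0
  set k := (J.herm u u).re with hkdef
  -- `e` is a maximum with multiplier `2 / n`
  have hc2 : c = r ^ 2 * 2 := by
    have h := hxc
    rw [hr] at h
    simp only [← Complex.coe_smul, map_smul, map_smulₛₗ, LinearMap.smul_apply, he3, smul_smul,
      Complex.conj_ofReal] at h
    have h2 := smul_left_injective ℂ he0 h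
    have h3 : r * (r * r * 2) = c * r := by exact_mod_cast h2
    have h4 : r * (c - r ^ 2 * 2) = 0 := by linear_combination -h3
    linarith [(mul_eq_zero.mp h4).resolve_left hr0]
  have hxn : (J.herm x x).re = r ^ 2 * n := by
    rw [hr]
    simp only [← Complex.coe_smul, herm_smul_left, herm_smul_right, Complex.conj_ofReal,
      Complex.re_ofReal_mul, ← hn]
    ring
  have hmax' : ∀ y ∈ J.realForm e, J.quartic y * n ≤ 2 * (J.herm y y).re ^ 2 := by
    intro y hy
    have h := hmax y hy
    rw [hxn, hc2] at h
    have hr2 : 0 < r ^ 2 := by positivity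
    nlinarith
  obtain ⟨c₃, hq⟩ := J.quartic_add_smul e u
  have e1 : (J.herm (J.D e e e) u).re = 0 := by
    rw [he3, herm_smul_left, Complex.mul_re, hue]; simp
  have e2 : (J.herm (J.D u u e) e).re = 2 * k := by
    have : J.D u u e = J.D e u u := J.symm _ _ _
    rw [this, herm_adjoint, J.symm u e e, huA.1, herm_smul_right]
    simp [hkdef]
  have e3 : (J.herm (J.D u e u) e).re = 2 * k := by
    rw [herm_adjoint, huA.2, herm_smul_right]
    simp [hkdef]
  have e4 : (J.herm (J.D e u e) u).re = 2 * k := by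
    rw [huA.2, herm_smul_left]
    simp [hkdef]
  have e5 : J.quartic e = 2 * n := by
    rw [quartic, he3, herm_smul_left]
    simp [hn]
  have hpoly := fun t : ℝ => hmax' (e + t • u) (add_mem heA ((J.realForm e).smul_mem t huA))
  simp only [hq, herm_self_add_smul, ← hn, ← hkdef, e1, e2, e3, e4, e5, hue] at hpoly
  obtain ⟨-, h1⟩ := quartic_nonneg (c₁ := 0) (c₂ := -8 * n * k) (c₃ := -c₃ * n)
    (c₄ := 2 * k ^ 2 - J.quartic u * n) (fun t => by linarith [hpoly t])
  nlinarith [mul_pos hepos hk]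

/-- The Peirce space `V₂(e)` of a primitive tripotent is the complex line spanned by `e`. -/
theorem peirce_two_of_isPrimitive {e : V} (he : J.IsPrimitive e) {z : V}
    (hz : z ∈ J.peirce e 2) : ∃ c : ℂ, z = c • e := by
  have hz1 := J.mem_peirce.mp hz
  have hq := J.mem_peirce.mp (triple_mem_peirce_two he.1 z)
  have hqq := triple_triple_of_mem_two he.1 hz
  obtain ⟨s, hs⟩ := realForm_of_isPrimitive he (a := z + (1 / 2 : ℂ) • J.D e z e) (by
    refine ⟨?_, ?_⟩
    · simp only [map_add, map_smul, hz1, hq]; module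
    · simp only [map_add, map_smulₛₗ, LinearMap.add_apply, LinearMap.smul_apply, hqq, map_div₀,
        map_one, map_ofNat]
      module)
  obtain ⟨t, ht⟩ := realForm_of_isPrimitive he
      (a := Complex.I • (z - (1 / 2 : ℂ) • J.D e z e)) (by
    refine ⟨?_, ?_⟩
    · simp only [map_sub, map_smul, hz1, hq]; module
    · simp only [map_sub, map_smulₛₗ, LinearMap.sub_apply, LinearMap.smul_apply, hqq, map_div₀,
        map_one, map_ofNat, Complex.conj_I]
      module)
  refine ⟨(1 / 2 : ℂ) * s - (1 / 2 : ℂ) * Complex.I * t, ?_⟩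
  have ht' : z - (1 / 2 : ℂ) • J.D e z e = -(Complex.I * t) • e := by
    have := congrArg (fun w => -Complex.I • w) ht
    simp only [smul_smul, ← Complex.coe_smul] at this
    simpa using this
  rw [← Complex.coe_smul] at hs
  linear_combination (norm := module) (1 / 2 : ℂ) • hs + (1 / 2 : ℂ) • ht'

end Primitive

/-! ### Elements of rank one -/

section RankOneSmul

variable {V : Type*} [AddCommGroup V] [Module ℂ V] {J : PosHermJordanTriple V}

/-- The algebraic description of the rank one elements, `{x V x} ⊆ ℂ x`. -/
def IsRankOne (J : PosHermJordanTriple V) (x : V) : Prop :=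
  ∀ v, ∃ c : ℂ, J.D x v x = c • x

theorem IsRankOne.smul {x : V} (h : J.IsRankOne x) (a : ℂ) : J.IsRankOne (a • x) := by
  intro v
  obtain ⟨c, hc⟩ := h v
  refine ⟨a * c, ?_⟩
  simp only [map_smul, LinearMap.smul_apply, hc]
  module

theorem isRankOne_smul_iff {x : V} {a : ℂ} (ha : a ≠ 0) :
    J.IsRankOne (a • x) ↔ J.IsRankOne x :=
  ⟨fun h => by simpa [smul_smul, inv_mul_cancel₀ ha] using h.smul a⁻¹, fun h => h.smul a⟩

end RankOneSmul

section RankOne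

variable {V : Type*} [NormedAddCommGroup V] [NormedSpace ℂ V] [FiniteDimensional ℂ V]
  {J : PosHermJordanTriple V}

theorem IsPrimitive.isRankOne {e : V} (he : J.IsPrimitive e) : J.IsRankOne e :=
  fun v => peirce_two_of_isPrimitive he (triple_mem_peirce_two he.1 v)

omit [FiniteDimensional ℂ V] in
theorem isPrimitive_of_isRankOne {e : V} (he : J.IsTripotent e) (he0 : e ≠ 0)
    (h : J.IsRankOne e) : J.IsPrimitive e := by
  refine ⟨he, he0, ?_⟩
  rintro ⟨e₁, e₂, h1, h2, h10, h20, horth, hsum⟩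
  have key : ∀ a b : V, J.IsTripotent a → J.D a b = 0 → e = a + b → a ∈ J.peirce e 2 := by
    intro a b ha hab hs
    have hba := J.D_eq_zero_of_swap hab
    have hbb : J.D b b a = 0 := by rw [J.symm, hab]; rfl
    rw [mem_peirce, hs]
    simp only [map_add, LinearMap.add_apply, hab, hba, J.isTripotent_iff.mp ha, hbb,
      LinearMap.zero_apply, add_zero]
  have hmul : ∀ a ∈ J.peirce e 2, ∃ c : ℂ, a = c • e := by
    intro a ha
    obtain ⟨c, hc⟩ := h (J.D e a e)
    rw [triple_triple_of_mem_two he ha] at hc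
    exact ⟨(1 / 4) * c, by linear_combination (norm := module) (1 / 4 : ℂ) • hc⟩
  obtain ⟨c, hc⟩ := hmul e₁ (key e₁ e₂ h1 horth hsum)
  obtain ⟨d, hd⟩ := hmul e₂ (key e₂ e₁ h2 (J.D_eq_zero_of_swap horth) (by rw [hsum, add_comm]))
  have hc0 : c ≠ 0 := by rintro rfl; simp at hc; exact h10 hc
  have hd0 : d ≠ 0 := by rintro rfl; simp at hd; exact h20 hd
  have h3 : J.D e₁ e₂ e = 0 := by rw [show J.D e₁ e₂ = 0 from horth]; rfl
  rw [hc, hd] at h3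
  simp only [map_smul, map_smulₛₗ, LinearMap.smul_apply, J.isTripotent_iff.mp he, smul_smul] at h3
  refine (smul_ne_zero ?_ he0) h3
  simpa using ⟨hd0, hc0⟩

/-- An element of rank one is a positive multiple of a primitive tripotent. -/
theorem IsRankOne.exists_isPrimitive {x : V} (h : J.IsRankOne x) (hx : x ≠ 0) :
    ∃ (e : V) (r : ℝ), J.IsPrimitive e ∧ 0 < r ∧ x = (r : ℂ) • e := by
  obtain ⟨c, hc⟩ := h x
  obtain ⟨hpos, him⟩ := pos_of_cube hc hx
  have hcr : c = (c.re : ℂ) := Complex.ext (by simp) (by simp [him])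
  rw [hcr] at hc
  have hs : 0 < Real.sqrt (2 / c.re) := Real.sqrt_pos.mpr (by positivity)
  have hs' : ((Real.sqrt (2 / c.re) : ℝ) : ℂ) ≠ 0 := by exact_mod_cast hs.ne'
  refine ⟨((Real.sqrt (2 / c.re) : ℝ) : ℂ) • x, (Real.sqrt (2 / c.re))⁻¹,
    isPrimitive_of_isRankOne (isTripotent_of_cube hpos hc) (smul_ne_zero hs' hx) (h.smul _),
    inv_pos.mpr hs, ?_⟩
  rw [smul_smul, Complex.ofReal_inv, inv_mul_cancel₀ hs', one_smul]

/-- A primitive tripotent is the first member of a frame. -/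
theorem IsPrimitive.exists_frame {e : V} (he : J.IsPrimitive e) :
    ∃ (r : ℕ) (f : Fin (r + 1) → V), J.IsFrame f ∧ f 0 = e := by
  classical
  let P : ℕ → Prop := fun r => ∃ f : Fin (r + 1) → V, f 0 = e ∧ (∀ i, J.IsPrimitive (f i)) ∧
    ∀ i j, i ≠ j → J.Orthogonal (f i) (f j)
  have hP0 : P 0 := ⟨fun _ => e, rfl, fun _ => he, fun i j h => absurd (Fin.ext (by omega)) h⟩
  have hbound : ∀ r, P r → r ≤ Module.finrank ℂ V := by
    rintro r ⟨f, -, hf, ho⟩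
    have hli : LinearIndependent ℂ f := by
      rw [Fintype.linearIndependent_iff]
      intro g hg i
      have h1 : J.D (∑ j, g j • f j) (f i) (f i) = 0 := by rw [hg]; simp
      rw [map_sum, LinearMap.sum_apply, LinearMap.sum_apply, Finset.sum_eq_single i] at h1
      · simp only [map_smul, LinearMap.smul_apply, J.isTripotent_iff.mp (hf i).1,
          smul_eq_zero] at h1
        exact h1.resolve_right (by simpa using (hf i).2.1)
      · intro j _ hj
        have : J.D (f j) (f i) = 0 := ho j i hj
        simp [this]
      · simp
    have := hli.fintype_card_le_finrank
    simp only [Fintype.card_fin] at this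
    omega
  have hspec : P (Nat.findGreatest P (Module.finrank ℂ V)) :=
    Nat.findGreatest_spec (Nat.zero_le _) hP0
  set r := Nat.findGreatest P (Module.finrank ℂ V)
  obtain ⟨f, hf0, hf, ho⟩ := hspec
  refine ⟨r, f, ⟨hf, ho, fun g hg hgo => ?_⟩, hf0⟩
  have hP : P (r + 1) := by
    refine ⟨Fin.snoc f g, ?_, ?_, ?_⟩
    · rw [← Fin.castSucc_zero, Fin.snoc_castSucc]; exact hf0
    · intro i
      refine Fin.lastCases ?_ (fun i => ?_) i
      · simpa using hg
      · simpa using hf i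
    · intro i j
      refine Fin.lastCases ?_ (fun i => ?_) i <;> refine Fin.lastCases ?_ (fun j => ?_) j
      · intro h; exact absurd rfl h
      · intro _
        simpa using (show J.Orthogonal g (f j) from J.D_eq_zero_of_swap (hgo j))
      · intro _
        simpa using hgo i
      · intro h
        simpa using ho i j (fun hij => h (by rw [hij]))
  have := Nat.le_findGreatest (hbound _ hP) hP
  omega

/-- The first characteristic variety consists of the lines `[x]` with `{x V x} ⊆ ℂ x`. -/
theorem mk_mem_mokVariety_iff {x : V} (hx : x ≠ 0) :
    Projectivization.mk ℂ x hx ∈ J.mokVariety 1 ↔ J.IsRankOne x := by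
  constructor
  · rintro ⟨y, hy, hxy, k, h1, h2, r, f, c, hf, -, -, hsum, hk⟩
    obtain rfl : k = 1 := le_antisymm h2 h1
    obtain ⟨i, hi⟩ := Set.ncard_eq_one.mp hk
    have hyi : y = (c i : ℂ) • f i := by
      rw [hsum]
      refine Finset.sum_eq_single i (fun j _ hj => ?_) (by simp)
      have : c j = 0 := by
        by_contra hcj
        exact hj (by simpa [hi] using (show j ∈ {i | c i ≠ 0} from hcj))
      simp [this]
    obtain ⟨a, ha⟩ := (Projectivization.mk_eq_mk_iff' ℂ x y hx hy).mp hxy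
    rw [← ha, hyi]
    exact ((hf.1 i).isRankOne.smul _).smul a
  · intro h
    obtain ⟨e, ρ, he, hρ, rfl⟩ := h.exists_isPrimitive hx
    obtain ⟨r, f, hf, hf0⟩ := he.exists_frame
    refine ⟨_, hx, rfl, 1, le_rfl, le_rfl, r + 1, f, fun i => if i = 0 then ρ else 0, hf, ?_, ?_,
      ?_, ?_⟩
    · intro i j hij
      dsimp only
      split_ifs with hj hi hi
      · exact le_rfl
      · exact absurd (Fin.le_zero_iff.mp (hj ▸ hij)) hi
      · exact hρ.le
      · exact le_rfl
    · intro i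
      dsimp only
      split_ifs
      · exact hρ.le
      · exact le_rfl
    · rw [Finset.sum_eq_single 0] <;> simp +contextual [hf0]
    · rw [Set.ncard_eq_one]
      refine ⟨0, ?_⟩
      ext i
      simp [hρ.ne']

end RankOne

/-! ### The Peirce reflection -/

section Reflection

variable {V : Type*} [AddCommGroup V] [Module ℂ V] {J : PosHermJordanTriple V}

/-- Two linear equivalences which are Peirce reflections of the same tripotent agree, and a Peirce
reflection exists: it is the polynomial `1 - 4 L + 2 L²` in `L = D(e, e)`. -/
theorem existsUnique_isPeirceReflection {e : V} (he : J.IsTripotent e) :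
    ∃! σ : V ≃ₗ[ℂ] V, J.IsPeirceReflection e σ := by
  have key : ∀ σ : V ≃ₗ[ℂ] V, J.IsPeirceReflection e σ → ∀ z,
      σ z = z - (4 : ℂ) • J.D e e z + (2 : ℂ) • J.D e e (J.D e e z) := by
    rintro σ ⟨h1, h0, h2⟩ z
    obtain ⟨z₀, hz0, z₁, hz1, z₂, hz2, rfl⟩ := exists_peirce_decomp he z
    rw [map_add, map_add, h0 _ hz0, h1 _ hz1, h2 _ hz2]
    rw [mem_peirce] at hz0 hz1 hz2
    simp only [map_add, hz0, hz1, hz2, map_smul]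
    module
  let s : V →ₗ[ℂ] V := LinearMap.id - (4 : ℂ) • J.D e e + (2 : ℂ) • (J.D e e ∘ₗ J.D e e)
  have hs : ∀ z, s z = z - (4 : ℂ) • J.D e e z + (2 : ℂ) • J.D e e (J.D e e z) := fun z => rfl
  have hinv : Function.Involutive s := by
    intro z
    simp only [hs, map_add, map_sub, map_smul, tripotent_cubic he]
    module
  refine ⟨LinearEquiv.ofInvolutive s hinv, ⟨?_, ?_, ?_⟩, fun τ hτ => ?_⟩
  · intro z hz
    rw [mem_peirce] at hz
    rw [LinearEquiv.coe_ofInvolutive, hs]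
    simp only [hz, map_smul]
    module
  · intro z hz
    rw [mem_peirce] at hz
    rw [LinearEquiv.coe_ofInvolutive, hs]
    simp only [hz, map_smul]
    module
  · intro z hz
    rw [mem_peirce] at hz
    rw [LinearEquiv.coe_ofInvolutive, hs]
    simp only [hz, map_smul]
    module
  · ext z
    rw [key τ hτ, LinearEquiv.coe_ofInvolutive, hs]

/-- A Peirce reflection acts on `V_n(e)` by `(-1) ^ n`, for every integer `n`. -/
theorem IsPeirceReflection.apply_of_mem {e : V} (he : J.IsTripotent e) {σ : V ≃ₗ[ℂ] V}
    (hσ : J.IsPeirceReflection e σ) {n : ℤ} {z : V} (hz : z ∈ J.peirce e n) :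
    σ z = (-1 : ℂ) ^ n • z := by
  obtain ⟨h1, h0, h2⟩ := hσ
  by_cases hn0 : n = 0
  · subst hn0; simpa using h0 z (by simpa using hz)
  by_cases hn1 : n = 1
  · subst hn1; simpa using h1 z (by simpa using hz)
  by_cases hn2 : n = 2
  · subst hn2; simpa using h2 z (by simpa using hz)
  have : z = 0 := eq_zero_of_mem_peirce he (by exact_mod_cast hn0) (by exact_mod_cast hn1)
    (by exact_mod_cast hn2) hz
  simp [this]

/-- The Peirce reflection is an automorphism: this is the Peirce rule read modulo two. -/
theorem IsPeirceReflection.isAutomorphism {e : V} (he : J.IsTripotent e) {σ : V ≃ₗ[ℂ] V}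
    (hσ : J.IsPeirceReflection e σ) : J.IsAutomorphism σ := by
  have key : ∀ (a b c : ℤ) (x y z : V), x ∈ J.peirce e a → y ∈ J.peirce e b →
      z ∈ J.peirce e c → σ (J.D x y z) = J.D (σ x) (σ y) (σ z) := by
    intro a b c x y z hx hy hz
    have hm : J.D x y z ∈ J.peirce e ((a - b + c : ℤ) : ℂ) := by
      push_cast
      exact J.peirce_rule (by simp) hx hy hz
    have hb : ((-1 : ℂ) ^ b)⁻¹ = (-1 : ℂ) ^ b := by
      rw [← inv_zpow, inv_neg_one]
    rw [hσ.apply_of_mem he hm, hσ.apply_of_mem he hx, hσ.apply_of_mem he hy,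
      hσ.apply_of_mem he hz, zpow_add₀ (by norm_num), zpow_sub₀ (by norm_num), div_eq_mul_inv, hb]
    simp only [map_smul, map_smulₛₗ, LinearMap.smul_apply, smul_smul, map_zpow₀, map_neg, map_one]
    congr 1
    ring
  have decomp : ∀ z : V, ∃ z₀ ∈ J.peirce e (0 : ℤ), ∃ z₁ ∈ J.peirce e (1 : ℤ),
      ∃ z₂ ∈ J.peirce e (2 : ℤ), z = z₀ + z₁ + z₂ := by
    simpa using exists_peirce_decomp he
  have k1 : ∀ (a b : ℤ) (x y : V), x ∈ J.peirce e a → y ∈ J.peirce e b →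
      ∀ z, σ (J.D x y z) = J.D (σ x) (σ y) (σ z) := by
    intro a b x y hx hy z
    obtain ⟨z₀, h0, z₁, h1, z₂, h2, rfl⟩ := decomp z
    simp only [map_add, key a b _ x y _ hx hy h0, key a b _ x y _ hx hy h1,
      key a b _ x y _ hx hy h2]
  have k2 : ∀ (a : ℤ) (x : V), x ∈ J.peirce e a →
      ∀ y z, σ (J.D x y z) = J.D (σ x) (σ y) (σ z) := by
    intro a x hx y z
    obtain ⟨z₀, h0, z₁, h1, z₂, h2, rfl⟩ := decomp y
    simp only [map_add, LinearMap.add_apply, k1 a _ x _ hx h0, k1 a _ x _ hx h1,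
      k1 a _ x _ hx h2]
  intro x y z
  obtain ⟨z₀, h0, z₁, h1, z₂, h2, rfl⟩ := decomp x
  simp only [map_add, LinearMap.add_apply, k2 _ _ h0, k2 _ _ h1, k2 _ _ h2]

theorem IsAutomorphism.herm_map {σ : V ≃ₗ[ℂ] V} (hσ : J.IsAutomorphism σ) (x y : V) :
    J.herm (σ x) (σ y) = J.herm x y := by
  have : J.D (σ x) (σ y) = σ.conj (J.D x y) := by
    ext z
    rw [LinearEquiv.conj_apply_apply, hσ, LinearEquiv.apply_symm_apply]
  rw [herm, this, LinearMap.trace_conj']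
  rfl

theorem IsAutomorphism.isRankOne_map_iff {σ : V ≃ₗ[ℂ] V} (hσ : J.IsAutomorphism σ) (x : V) :
    J.IsRankOne (σ x) ↔ J.IsRankOne x := by
  constructor
  · intro h v
    obtain ⟨c, hc⟩ := h (σ v)
    exact ⟨c, σ.injective (by rw [hσ, hc, map_smul])⟩
  · intro h v
    obtain ⟨c, hc⟩ := h (σ.symm v)
    refine ⟨c, ?_⟩
    rw [← map_smul, ← hc, hσ, LinearEquiv.apply_symm_apply]

end Reflection

/-! ### Automorphisms act on projective space by isometries -/

section Isometry

variable {V : Type*} [NormedAddCommGroup V] [NormedSpace ℂ V] [FiniteDimensional ℂ V]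
  {J : PosHermJordanTriple V}

omit [FiniteDimensional ℂ V] in
theorem fubiniStudy_zero (x : V) (u v : J.perp x) :
    J.fubiniStudy x 0 u v = (J.herm (u : V) v / J.herm x x).re := by
  have h : J.herm (u : V) x = 0 := u.2
  simp [fubiniStudy, h]

omit [FiniteDimensional ℂ V] in
theorem IsAutomorphism.smul_mem_perp {σ : V ≃ₗ[ℂ] V} (hσ : J.IsAutomorphism σ) {x y : V} {c : ℂ}
    (hc : c ≠ 0) (h : σ x = c • y) (z : J.perp x) : c⁻¹ • σ (z : V) ∈ J.perp y := by
  have hy : y = c⁻¹ • σ x := by rw [h, smul_smul, inv_mul_cancel₀ hc, one_smul]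
  have hz : J.herm (z : V) x = 0 := z.2
  change J.herm (c⁻¹ • σ (z : V)) y = 0
  rw [hy, herm_smul_left, herm_smul_right, hσ.herm_map, hz]
  simp

/-- The linear map representing an automorphism in the affine charts centred at `[x]` and at
`[y] = [σ x]`. -/
noncomputable def IsAutomorphism.perpMap {σ : V ≃ₗ[ℂ] V} (hσ : J.IsAutomorphism σ) {x y : V} {c : ℂ}
    (hc : c ≠ 0) (h : σ x = c • y) : J.perp x →L[ℂ] J.perp y :=
  (((c⁻¹ • σ.toLinearMap) ∘ₗ (J.perp x).subtype).codRestrict (J.perp y)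
    (hσ.smul_mem_perp hc h)).toContinuousLinearMap

theorem IsAutomorphism.perpMap_coe {σ : V ≃ₗ[ℂ] V} (hσ : J.IsAutomorphism σ) {x y : V} {c : ℂ}
    (hc : c ≠ 0) (h : σ x = c • y) (z : J.perp x) :
    (hσ.perpMap hc h z : V) = c⁻¹ • σ (z : V) := rfl

theorem IsAutomorphism.fderiv_perpMap {σ : V ≃ₗ[ℂ] V} (hσ : J.IsAutomorphism σ) {x y : V} {c : ℂ}
    (hc : c ≠ 0) (h : σ x = c • y) (z u : J.perp x) :
    fderiv ℝ (hσ.perpMap hc h) z u = hσ.perpMap hc h u := by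
  have : HasFDerivAt (hσ.perpMap hc h) ((hσ.perpMap hc h).restrictScalars ℝ) z :=
    ((hσ.perpMap hc h).restrictScalars ℝ).hasFDerivAt
  rw [this.fderiv]
  rfl

theorem IsAutomorphism.isChartRep {σ : V ≃ₗ[ℂ] V} (hσ : J.IsAutomorphism σ) {x y : V}
    (hx : x ≠ 0) (hy : y ≠ 0) {c : ℂ} (hc : c ≠ 0) (h : σ x = c • y) :
    J.IsChartRep (Projectivization.map σ.toLinearMap σ.injective) hx hy (hσ.perpMap hc h) := by
  refine Filter.Eventually.of_forall fun z => ?_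
  rw [chart, chart, Projectivization.map_mk, Projectivization.mk_eq_mk_iff']
  refine ⟨c, ?_⟩
  rw [hσ.perpMap_coe, smul_add, smul_smul, mul_inv_cancel₀ hc, one_smul, ← h]
  simp

omit [FiniteDimensional ℂ V] in
theorem IsAutomorphism.bijective_map {σ : V ≃ₗ[ℂ] V} :
    Function.Bijective (Projectivization.map σ.toLinearMap σ.injective) := by
  refine ⟨Projectivization.map_injective _ σ.injective, fun p => ?_⟩
  induction p using Projectivization.ind with
  | h v hv =>
    refine ⟨Projectivization.mk ℂ (σ.symm v) (by simpa using hv), ?_⟩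
    rw [Projectivization.map_mk]
    simp

theorem IsAutomorphism.isFubiniStudyIsometry {σ : V ≃ₗ[ℂ] V} (hσ : J.IsAutomorphism σ) :
    J.IsFubiniStudyIsometry (Projectivization.map σ.toLinearMap σ.injective) := by
  refine ⟨IsAutomorphism.bijective_map, fun x y hx hy hxy => ?_⟩
  rw [Projectivization.map_mk, Projectivization.mk_eq_mk_iff'] at hxy
  obtain ⟨c, hc⟩ := hxy
  have h : σ x = c • y := hc.symm
  have hc0 : c ≠ 0 := by
    rintro rfl
    exact hx (σ.injective (by rw [h, zero_smul, map_zero]))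
  refine ⟨hσ.perpMap hc0 h, hσ.isChartRep hx hy hc0 h,
    ((hσ.perpMap hc0 h).restrictScalars ℝ).contDiff.contDiffAt, fun u v => ?_⟩
  rw [hσ.fderiv_perpMap, hσ.fderiv_perpMap, fubiniStudy_zero, fubiniStudy_zero,
    hσ.perpMap_coe, hσ.perpMap_coe]
  have hxx : J.herm x x = c * starRingEnd ℂ c * J.herm y y := by
    rw [← hσ.herm_map x x, h, herm_smul_left, herm_smul_right]; ring
  have hcc : starRingEnd ℂ c ≠ 0 := by simpa using hc0
  have hyy := J.herm_self_ne_zero hy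
  rw [hxx, herm_smul_left, herm_smul_right, hσ.herm_map, map_inv₀]
  congr 1
  field_simp

theorem IsAutomorphism.image_mokVariety {σ : V ≃ₗ[ℂ] V} (hσ : J.IsAutomorphism σ) :
    Projectivization.map σ.toLinearMap σ.injective '' J.mokVariety 1 = J.mokVariety 1 := by
  ext p
  constructor
  · rintro ⟨q, hq, rfl⟩
    induction q using Projectivization.ind with
    | h v hv =>
      rw [Projectivization.map_mk, mk_mem_mokVariety_iff]
      exact (hσ.isRankOne_map_iff v).mpr ((mk_mem_mokVariety_iff hv).mp hq)
  · intro hp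
    obtain ⟨q, rfl⟩ := (IsAutomorphism.bijective_map (σ := σ)).2 p
    refine ⟨q, ?_, rfl⟩
    induction q using Projectivization.ind with
    | h v hv =>
      rw [Projectivization.map_mk, mk_mem_mokVariety_iff] at hp
      exact (mk_mem_mokVariety_iff hv).mpr ((hσ.isRankOne_map_iff v).mp hp)

end Isometry

/-! ### The rank one elements near a primitive tripotent -/

section Chart

variable {V : Type*} [NormedAddCommGroup V] [NormedSpace ℂ V] [FiniteDimensional ℂ V]
  {J : PosHermJordanTriple V}

omit [FiniteDimensional ℂ V] in
theorem D_one_tripotent_zero {e u w : V} (he : J.IsTripotent e) (hu : u ∈ J.peirce e 1)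
    (hw : w ∈ J.peirce e 0) : J.D u e w = 0 :=
  eq_zero_of_mem_peirce he (by norm_num) (by norm_num) (by norm_num)
    (J.peirce_rule (map_ofNat _ 2) hu (self_mem_peirce he) hw)

omit [FiniteDimensional ℂ V] in
theorem D_one_tripotent_one {e u v : V} (he : J.IsTripotent e) (hu : u ∈ J.peirce e 1)
    (hv : v ∈ J.peirce e 1) : J.D u e v ∈ J.peirce e 0 := by
  have := J.peirce_rule (map_ofNat _ 2) hu (self_mem_peirce he) hv
  norm_num at this
  exact this

set_option maxSynthPendingDepth 3 in
/-- The curve `exp(t D(u, e)) e = e + t u + ½ t² {u e u}` consists of elements of rank one: along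
it `{x(t) y(t) x(t)}`, for `y(t) = exp((1 - t) D(e, u)) v`, solves the same linear differential
equation as `x(t)`. -/
theorem isRankOne_exp {e u : V} (he : J.IsPrimitive e) (hu : u ∈ J.peirce e 1) :
    J.IsRankOne (e + u + (1 / 2 : ℂ) • J.D u e u) := by
  intro v
  have he1 := he.1
  set w := (1 / 2 : ℂ) • J.D u e u with hw
  have hw0 : w ∈ J.peirce e 0 := Submodule.smul_mem _ _ (D_one_tripotent_one he1 hu hu)
  have hNe : J.D u e e = u := by rw [J.symm]; simpa using J.mem_peirce.mp hu
  have hNu : J.D u e u = (2 : ℝ) • w := by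
    rw [← Complex.coe_smul, hw, smul_smul]; norm_num
  have hNw : J.D u e w = 0 := D_one_tripotent_zero he1 hu hw0
  have hM3 : J.D e u (J.D e u (J.D e u v)) = 0 := by
    have step : ∀ a : ℂ, a + 3 ≠ 0 → a + 3 ≠ 1 → a + 3 ≠ 2 → ∀ z ∈ J.peirce e a,
        J.D e u (J.D e u (J.D e u z)) = 0 := by
      intro a h0 h1 h2 z hz
      have r1 := J.peirce_rule (by simp) (self_mem_peirce he1) hu hz
      have r2 := J.peirce_rule (by simp) (self_mem_peirce he1) hu r1
      have r3 := J.peirce_rule (by simp) (self_mem_peirce he1) hu r2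
      rw [show (2 : ℂ) - 1 + (2 - 1 + (2 - 1 + a)) = a + 3 by ring] at r3
      exact eq_zero_of_mem_peirce he1 h0 h1 h2 r3
    obtain ⟨z₀, h0, z₁, h1, z₂, h2, rfl⟩ := exists_peirce_decomp he1 v
    simp only [map_add, step 0 (by norm_num) (by norm_num) (by norm_num) _ h0,
      step 1 (by norm_num) (by norm_num) (by norm_num) _ h1,
      step 2 (by norm_num) (by norm_num) (by norm_num) _ h2, add_zero]
  let x : ℝ → V := fun t => e + t • u + t ^ 2 • w
  let y : ℝ → V := fun t => v - (t - 1) • J.D e u v + ((t - 1) ^ 2 / 2) • J.D e u (J.D e u v)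
  have hsm : ∀ (a b : V) (t : ℝ) (z : V), J.D a b (t • z) = t • J.D a b z := fun a b t z => by
    rw [← Complex.coe_smul, map_smul, Complex.coe_smul]
  have hx : ∀ t, HasDerivAt x (J.D u e (x t)) t := by
    intro t
    have h1 : HasDerivAt (fun t : ℝ => t • u) ((1 : ℝ) • u) t := (hasDerivAt_id t).smul_const u
    have h2 : HasDerivAt (fun t : ℝ => t ^ 2 • w) ((2 * t) • w) t := by
      simpa using (hasDerivAt_pow 2 t).smul_const w
    refine ((h1.const_add e).add h2).congr_deriv ?_
    simp only [x, map_add, hsm, hNe, hNu, hNw]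
    module
  have hy : ∀ t, HasDerivAt y (-J.D e u (y t)) t := by
    intro t
    have h1 : HasDerivAt (fun t : ℝ => (t - 1) • J.D e u v) ((1 : ℝ) • J.D e u v) t :=
      ((hasDerivAt_id t).sub_const 1).smul_const _
    have h2 : HasDerivAt (fun t : ℝ => ((t - 1) ^ 2 / 2) • J.D e u (J.D e u v))
        ((t - 1) • J.D e u (J.D e u v)) t := by
      have := ((((hasDerivAt_id t).sub_const 1).pow 2).div_const 2).smul_const
        (J.D e u (J.D e u v))
      refine this.congr_deriv ?_
      congr 1
      simp
    refine ((h1.const_sub v).add h2).congr_deriv ?_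
    simp only [y, map_add, map_sub, hsm, hM3]
    module
  obtain ⟨c, hc⟩ := he.isRankOne (y 0)
  let N : V →L[ℝ] V := J.tripleL u e
  have hF : ∀ t, HasDerivAt (fun t => J.D (x t) (y t) (x t)) (N (J.D (x t) (y t) (x t))) t := by
    intro t
    have h1 : HasDerivAt (fun t => J.tripleL (x t)) (J.tripleL (J.D u e (x t))) t :=
      ((hasDerivAt_const t J.tripleL).clm_apply (hx t)).congr_deriv (by simp)
    have h2 := (h1.clm_apply (hy t)).clm_apply (hx t)
    refine h2.congr_deriv ?_
    change _ = J.D u e (J.D (x t) (y t) (x t))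
    rw [J.jordan u e (x t) (y t) (x t), J.symm (y t) u e]
    simp
    abel
  have hG : ∀ t, HasDerivAt (fun t => c • x t) (N (c • x t)) t := by
    intro t
    refine ((hx t).const_smul c).congr_deriv ?_
    change _ = J.D u e (c • x t)
    rw [map_smul]
  have huniq := ODE_solution_unique_univ (v := fun _ => N) (s := fun _ => Set.univ) (t₀ := 0)
    (fun _ => N.lipschitz.lipschitzOnWith) (fun t => ⟨hF t, trivial⟩)
    (fun t => ⟨hG t, trivial⟩) (by simpa [x] using hc)
  have h1 := congrFun huniq 1
  refine ⟨c, ?_⟩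
  simpa [x, y] using h1

/-- Among the elements `e + u + w` with `u ∈ V₁(e)` and `w ∈ V₀(e)`, those of rank one form the
graph `w = ½ {u e u}`. -/
theorem isRankOne_add_iff {e u w : V} (he : J.IsPrimitive e) (hu : u ∈ J.peirce e 1)
    (hw : w ∈ J.peirce e 0) : J.IsRankOne (e + u + w) ↔ w = (1 / 2 : ℂ) • J.D u e u := by
  refine ⟨fun h => ?_, fun h => h ▸ isRankOne_exp he hu⟩
  obtain ⟨c, hc⟩ := h e
  have he1 := he.1
  have hwe : J.D w e = 0 := D_zero_two he1 hw (self_mem_peirce he1)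
  have huu := D_one_tripotent_one he1 hu hu
  have heu : J.D e e u = u := by simpa using J.mem_peirce.mp hu
  have hew : J.D e e w = 0 := by simpa using J.mem_peirce.mp hw
  have hue : J.D u e e = u := by rw [J.symm, heu]
  simp only [map_add, LinearMap.add_apply, hwe, J.isTripotent_iff.mp he1, heu, hew, hue,
    D_one_tripotent_zero he1 hu hw, add_zero, smul_add] at hc
  have hce : (2 - c) * J.herm e e = 0 := by
    have h2 : (starRingEnd ℂ) 2 = (2 : ℂ) := map_ofNat _ 2
    have h := congrArg (fun z => J.herm z e) hc
    simp only [herm_add_left, herm_smul_left,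
      J.herm_peirce h2 (by norm_num) hu (self_mem_peirce he1),
      J.herm_peirce h2 (by norm_num) hw (self_mem_peirce he1),
      J.herm_peirce h2 (by norm_num) huu (self_mem_peirce he1)] at h
    linear_combination h
  have hc2 : c = 2 := by
    have := (mul_eq_zero.mp hce).resolve_right (J.herm_self_ne_zero he.2.1)
    linear_combination -this
  rw [hc2] at hc
  linear_combination (norm := module) (-1 / 2 : ℂ) • hc

theorem isRankOne_smul_add_iff {e u w : V} (he : J.IsPrimitive e) (hu : u ∈ J.peirce e 1)
    (hw : w ∈ J.peirce e 0) {r : ℂ} (hr : r ≠ 0) :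
    J.IsRankOne (r • e + (u + w)) ↔ w = (1 / 2 : ℂ) • r⁻¹ • J.D u e u := by
  have h : r • e + (u + w) = r • (e + r⁻¹ • u + r⁻¹ • w) := by
    match_scalars <;> field_simp
  rw [h, isRankOne_smul_iff hr, isRankOne_add_iff he (Submodule.smul_mem _ _ hu)
    (Submodule.smul_mem _ _ hw)]
  simp only [map_smul, LinearMap.smul_apply]
  constructor
  · intro h
    have := congrArg (fun z => r • z) h
    simp only [smul_smul, mul_inv_cancel₀ hr, one_smul] at this
    rw [this, smul_smul]
    congr 1
    field_simp
  · intro h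
    rw [h]
    module

omit [FiniteDimensional ℂ V] in
theorem mem_perp_iff {x z : V} : z ∈ J.perp x ↔ J.herm z x = 0 := Iff.rfl

omit [FiniteDimensional ℂ V] in
theorem perp_smul {e : V} {r : ℂ} (hr : r ≠ 0) {z : V} :
    z ∈ J.perp (r • e) ↔ J.herm z e = 0 := by
  rw [mem_perp_iff, herm_smul_right]
  simp [hr]

/-- The orthogonal complement of a primitive tripotent is `V₁(e) ⊕ V₀(e)`. -/
theorem exists_decomp_of_herm_eq_zero {e z : V} (he : J.IsPrimitive e) (hz : J.herm z e = 0) :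
    ∃ u ∈ J.peirce e 1, ∃ w ∈ J.peirce e 0, z = u + w := by
  obtain ⟨z₀, h0, z₁, h1, z₂, h2, rfl⟩ := exists_peirce_decomp he.1 z
  obtain ⟨c, rfl⟩ := peirce_two_of_isPrimitive he h2
  have hh : (starRingEnd ℂ) 2 = (2 : ℂ) := map_ofNat _ 2
  rw [herm_add_left, herm_add_left, J.herm_peirce hh (by norm_num) h0 (self_mem_peirce he.1),
    J.herm_peirce hh (by norm_num) h1 (self_mem_peirce he.1), herm_smul_left, zero_add,
    zero_add] at hz
  have hc : c = 0 := (mul_eq_zero.mp hz).resolve_right (J.herm_self_ne_zero he.2.1)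
  exact ⟨z₁, h1, z₀, h0, by rw [hc]; simp [add_comm]⟩

end Chart

end PosHermJordanTriple

/-! ### Holomorphic maps of several variables are smooth -/

namespace ChartGeometry

section Holomorphic

variable {E F : Type*} [NormedAddCommGroup E] [NormedSpace ℂ E] [FiniteDimensional ℂ E]
  [NormedAddCommGroup F] [NormedSpace ℂ F] [FiniteDimensional ℂ F]

/-- A directional derivative of a holomorphic map of several variables is holomorphic: it is
given by a Cauchy integral over circles in the direction `b`, which can be differentiated under
the integral sign because the derivative of a bounded holomorphic map is locally bounded. -/
theorem differentiableOn_fderiv_apply {f : E → F} {U : Set E} (hU : IsOpen U)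
    (hf : DifferentiableOn ℂ f U) (b : E) : DifferentiableOn ℂ (fun s => fderiv ℂ f s b) U := by
  have : CompleteSpace F := FiniteDimensional.complete ℂ F
  have : ProperSpace E := FiniteDimensional.proper ℂ E
  have : FiniteDimensional ℂ (E →L[ℂ] F) := inferInstance
  have : ProperSpace (E →L[ℂ] F) := FiniteDimensional.proper ℂ _
  borelize E
  borelize (E →L[ℂ] F)
  intro s₀ hs₀
  obtain ⟨R, hR, hRU⟩ := Metric.nhds_basis_closedBall.mem_iff.mp (hU.mem_nhds hs₀)
  obtain ⟨C, hC⟩ := ((isCompact_closedBall s₀ R).image_of_continuousOn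
    (hf.continuousOn.mono hRU)).isBounded.exists_norm_le
  replace hC : ∀ p ∈ Metric.closedBall s₀ R, ‖f p‖ ≤ C := fun p hp => hC _ ⟨p, hp, rfl⟩
  have hder : ∀ p ∈ Metric.ball s₀ (R / 2), ‖fderiv ℂ f p‖ ≤ (2 * C + 1) / (R / 2) := by
    intro p hp
    have hsub : Metric.ball p (R / 2) ⊆ Metric.closedBall s₀ R := by
      intro q hq
      rw [Metric.mem_ball] at hp hq
      rw [Metric.mem_closedBall]
      linarith [dist_triangle q p s₀]
    have hpR : p ∈ Metric.closedBall s₀ R := hsub (Metric.mem_ball_self (by linarith))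
    refine Complex.norm_fderiv_le_div_of_mapsTo_ball ((hf.mono hRU).mono hsub) ?_ (by linarith)
    intro q hq
    rw [Metric.mem_closedBall, dist_eq_norm]
    linarith [norm_sub_le (f q) (f p), hC q (hsub hq), hC p hpR]
  set r := R / (4 * (‖b‖ + 1)) with hr
  have hb1 : 0 < ‖b‖ + 1 := by positivity
  have hr0 : 0 < r := by positivity
  have hrb : r * ‖b‖ ≤ R / 4 := by
    rw [hr, div_mul_eq_mul_div, div_le_div_iff₀ (by positivity) (by norm_num)]
    nlinarith [norm_nonneg b]
  have hmem : ∀ s ∈ Metric.ball s₀ (R / 4), ∀ ζ : ℂ, ‖ζ‖ ≤ r →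
      s + ζ • b ∈ Metric.ball s₀ (R / 2) := by
    intro s hs ζ hζ
    rw [mem_ball_iff_norm] at hs ⊢
    have h1 : ‖ζ • b‖ ≤ R / 4 := by
      rw [norm_smul]
      exact (mul_le_mul_of_nonneg_right hζ (norm_nonneg b)).trans hrb
    have : s + ζ • b - s₀ = (s - s₀) + ζ • b := by abel
    rw [this]
    linarith [norm_add_le (s - s₀) (ζ • b)]
  have hballU : Metric.ball s₀ (R / 2) ⊆ U := fun q hq => hRU (by
    rw [Metric.mem_ball] at hq
    rw [Metric.mem_closedBall]
    linarith)
  have hdiff : ∀ p ∈ Metric.ball s₀ (R / 2), DifferentiableAt ℂ f p := fun p hp =>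
    hf.differentiableAt (hU.mem_nhds (hballU hp))
  -- the Cauchy formula for the directional derivative
  let k : ℝ → ℂ := fun θ => deriv (circleMap 0 r) θ * ((circleMap 0 r θ) ^ 2)⁻¹
  have hk : Continuous k := by
    have h0 : ∀ θ, circleMap 0 r θ ≠ 0 := fun θ => circleMap_ne_center hr0.ne'
    simp only [k, deriv_circleMap]
    exact ((continuous_circleMap 0 r).mul continuous_const).mul
      (((continuous_circleMap 0 r).pow 2).inv₀ fun θ => pow_ne_zero 2 (h0 θ))
  have hcirc : ∀ θ, ‖circleMap 0 r θ‖ ≤ r := fun θ => by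
    rw [norm_circleMap_zero, abs_of_pos hr0]
  have hcauchy : ∀ s ∈ Metric.ball s₀ (R / 4), fderiv ℂ f s b
      = (2 * Real.pi * Complex.I : ℂ)⁻¹ •
        ∫ θ in (0 : ℝ)..2 * Real.pi, k θ • f (s + circleMap 0 r θ • b) := by
    intro s hs
    have hpre : IsOpen ((fun ζ : ℂ => s + ζ • b) ⁻¹' Metric.ball s₀ (R / 2)) :=
      Metric.isOpen_ball.preimage (by fun_prop)
    have hd : DifferentiableOn ℂ (fun ζ : ℂ => f (s + ζ • b))
        ((fun ζ : ℂ => s + ζ • b) ⁻¹' Metric.ball s₀ (R / 2)) := by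
      intro ζ hζ
      exact ((hdiff _ hζ).comp ζ (by fun_prop)).differentiableWithinAt
    have h := Complex.two_pi_I_inv_smul_circleIntegral_sub_sq_inv_smul_of_differentiable hpre
      (c := 0) (w₀ := 0) (R := r) (fun ζ hζ => hmem s hs ζ (by simpa using hζ)) hd
      (Metric.mem_ball_self hr0)
    have hs2 : DifferentiableAt ℂ f (s + (0 : ℂ) • b) :=
      hdiff _ (hmem s hs 0 (by simpa using hr0.le))
    have hline : HasDerivAt (fun ζ : ℂ => s + ζ • b) b 0 := by
      simpa using ((hasDerivAt_id (0 : ℂ)).smul_const b).const_add s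
    have hchain := (hs2.hasFDerivAt.comp_hasDerivAt (0 : ℂ) hline).deriv
    have hchain' : deriv (fun ζ : ℂ => f (s + ζ • b)) 0 = fderiv ℂ f s b := by
      simpa [Function.comp_def] using hchain
    rw [← hchain', ← h, circleIntegral]
    simp only [sub_zero, smul_smul, k]
  let G : E → ℝ → F := fun s θ => k θ • f (s + circleMap 0 r θ • b)
  let G' : E → ℝ → E →L[ℂ] F := fun s θ => k θ • fderiv ℂ f (s + circleMap 0 r θ • b)
  have hGc : ∀ s ∈ Metric.ball s₀ (R / 4), Continuous (G s) := by
    intro s hs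
    refine hk.smul ?_
    rw [continuous_iff_continuousAt]
    intro θ
    refine ContinuousAt.comp (hdiff _ (hmem s hs _ (hcirc θ))).continuousAt ?_
    exact (continuous_const.add ((continuous_circleMap 0 r).smul continuous_const)).continuousAt
  have hball : Metric.ball s₀ (R / 4) ∈ nhds s₀ := Metric.ball_mem_nhds _ (by linarith)
  have hG : HasFDerivAt (fun s => ∫ θ in (0 : ℝ)..2 * Real.pi, G s θ)
      (∫ θ in (0 : ℝ)..2 * Real.pi, G' s₀ θ) s₀ := by
    refine intervalIntegral.hasFDerivAt_integral_of_dominated_of_fderiv_le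
      (bound := fun θ => ‖k θ‖ * ((2 * C + 1) / (R / 2))) hball ?_ ?_ ?_ ?_ ?_ ?_
    · filter_upwards [hball] with s hs
      exact (hGc s hs).aestronglyMeasurable
    · exact (hGc s₀ (Metric.mem_ball_self (by linarith))).intervalIntegrable _ _
    · have h1 : Measurable fun θ : ℝ => fderiv ℂ f (s₀ + circleMap 0 r θ • b) :=
        (measurable_fderiv ℂ f).comp (continuous_const.add
          ((continuous_circleMap 0 r).smul continuous_const)).measurable
      exact (hk.measurable.smul h1).aestronglyMeasurable
    · refine Filter.Eventually.of_forall fun θ _ s hs => ?_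
      rw [norm_smul]
      exact mul_le_mul_of_nonneg_left (hder _ (hmem s hs _ (hcirc θ))) (norm_nonneg _)
    · exact (hk.norm.mul continuous_const).intervalIntegrable _ _
    · refine Filter.Eventually.of_forall fun θ _ s hs => ?_
      have h1 : HasFDerivAt (fun s => f (s + circleMap 0 r θ • b))
          (fderiv ℂ f (s + circleMap 0 r θ • b)) s := by
        have h2 := (hdiff _ (hmem s hs _ (hcirc θ))).hasFDerivAt
        simpa [Function.comp_def] using h2.comp s ((hasFDerivAt_id s).add_const (circleMap 0 r θ • b))
      exact h1.const_smul (k θ)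
  have hfin : DifferentiableAt ℂ (fun s => fderiv ℂ f s b) s₀ := by
    refine (hG.differentiableAt.const_smul (2 * Real.pi * Complex.I : ℂ)⁻¹).congr_of_eventuallyEq ?_
    filter_upwards [hball] with s hs
    exact hcauchy s hs
  exact hfin.differentiableWithinAt

end Holomorphic

section Holomorphic

variable {E F : Type*} [NormedAddCommGroup E] [NormedSpace ℂ E] [FiniteDimensional ℂ E]
  [NormedAddCommGroup F] [NormedSpace ℂ F] [FiniteDimensional ℂ F]

theorem contDiffOn_one_of_holomorphic {f : E → F} {U : Set E} (hU : IsOpen U)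
    (hf : DifferentiableOn ℂ f U) : ContDiffOn ℂ 1 f U := by
  have h : ContDiffOn ℂ (0 + 1) f U := by
    refine contDiffOn_succ_of_fderiv_apply hf (by simp) fun b => ?_
    rw [contDiffOn_zero]
    refine (differentiableOn_fderiv_apply hU hf b).continuousOn.congr fun s hs => ?_
    rw [fderivWithin_of_isOpen hU hs]
  simpa using h

end Holomorphic

/-! ### Graphs of quadratic maps -/

/-- A complex subspace `range proj` of `E` with a complement `ker proj`, and a symmetric bilinear
map `form` from the subspace to the complement, extended by zero to `E`. -/
structure QuadraticGraph (E : Type*) [NormedAddCommGroup E] [NormedSpace ℂ E] where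
  /-- The projection onto the subspace. -/
  proj : E →L[ℂ] E
  /-- The bilinear map. -/
  form : E →L[ℂ] E →L[ℂ] E
  proj_proj : ∀ z, proj (proj z) = proj z
  form_comm : ∀ z w, form z w = form w z
  form_proj : ∀ z w, form z (proj w) = form z w
  proj_form : ∀ z w, proj (form z w) = 0

namespace QuadraticGraph

section

variable {E : Type*} [NormedAddCommGroup E] [NormedSpace ℂ E] (G : QuadraticGraph E)

/-- The graph of the quadratic map `u ↦ ½ form u u`. -/
def carrier : Set E := {z | z - G.proj z = (1 / 2 : ℂ) • G.form z z}

theorem mem_carrier {z : E} : z ∈ G.carrier ↔ z - G.proj z = (1 / 2 : ℂ) • G.form z z := Iff.rfl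

theorem form_proj_left (z w : E) : G.form (G.proj z) w = G.form z w := by
  rw [G.form_comm, G.form_proj, G.form_comm]

theorem form_form (z v w : E) : G.form z (G.form v w) = 0 := by
  rw [← G.form_proj, G.proj_form, map_zero]

theorem form_form_left (z v w : E) : G.form (G.form v w) z = 0 := by
  rw [G.form_comm, G.form_form]

theorem add_form_mem_carrier {u : E} (hu : G.proj u = u) :
    u + (1 / 2 : ℂ) • G.form u u ∈ G.carrier := by
  rw [mem_carrier]
  simp only [map_add, map_smul, add_apply, smul_apply,
    G.proj_form, G.form_form, G.form_form_left, hu]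
  simp

theorem eq_of_mem_carrier {z : E} (hz : z ∈ G.carrier) :
    z = G.proj z + (1 / 2 : ℂ) • G.form (G.proj z) (G.proj z) := by
  rw [mem_carrier] at hz
  rw [G.form_proj, G.form_proj_left, ← hz]
  abel

theorem hasFDerivAt_form_self (z : E) :
    HasFDerivAt (fun z => (1 / 2 : ℂ) • G.form z z) (G.form z) z := by
  have h := ((G.form.hasFDerivAt (x := z)).clm_apply (hasFDerivAt_id z)).const_smul (1 / 2 : ℂ)
  refine h.congr_fderiv ?_
  ext w
  simp only [smul_apply, add_apply,
    ContinuousLinearMap.comp_apply, ContinuousLinearMap.flip_apply, ContinuousLinearMap.id_apply,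
    id, G.form_comm w z]
  module

/-- The tangent space at the origin of the graph of a quadratic map. -/
theorem tangentSet_zero : tangentSet G.carrier 0 = {u | G.proj u = u} := by
  ext u
  constructor
  · rintro ⟨γ, h0, hγ, hd⟩
    have h1 : HasDerivAt (fun t => γ t - G.proj (γ t)) (u - G.proj u) 0 :=
      hd.sub ((G.proj.restrictScalars ℝ).hasFDerivAt.comp_hasDerivAt 0 hd)
    have h2 : HasDerivAt (fun t => (1 / 2 : ℂ) • G.form (γ t) (γ t)) (G.form (γ 0) u) 0 :=
      ((G.hasFDerivAt_form_self (γ 0)).restrictScalars ℝ).comp_hasDerivAt 0 hd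
    have h3 : (fun t => γ t - G.proj (γ t)) =ᶠ[nhds 0]
        fun t => (1 / 2 : ℂ) • G.form (γ t) (γ t) := hγ
    have h4 := h1.unique (h2.congr_of_eventuallyEq h3)
    rw [h0, map_zero, zero_apply] at h4
    exact (sub_eq_zero.mp h4).symm
  · intro hu
    refine ⟨fun t => ((t : ℂ) • u) + (1 / 2 : ℂ) • G.form ((t : ℂ) • u) ((t : ℂ) • u), by simp,
      Filter.Eventually.of_forall fun t => G.add_form_mem_carrier (by
        rw [map_smul, show G.proj u = u from hu]), ?_⟩
    have h1 : HasDerivAt (fun t : ℝ => (t : ℂ) • u) u 0 := by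
      simpa using (Complex.ofRealCLM.hasDerivAt (x := (0 : ℝ))).smul_const u
    have h2 : HasDerivAt
        (fun t : ℝ => (1 / 2 : ℂ) • G.form ((t : ℂ) • u) ((t : ℂ) • u))
        (G.form (((0 : ℝ) : ℂ) • u) u) 0 :=
      ((G.hasFDerivAt_form_self _).restrictScalars ℝ).comp_hasDerivAt 0 h1
    exact (h1.add h2).congr_deriv (by simp)

variable [FiniteDimensional ℂ E]

/-- The graph of a quadratic map is a complex submanifold, parametrized by its projection. -/
theorem exists_isLocalParam : ∃ (d : ℕ) (W : Set (Fin d → ℂ)) (f : (Fin d → ℂ) → E),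
    IsLocalParam G.carrier W f ∧ f 0 = 0 := by
  let T : Submodule ℂ E := LinearMap.range G.proj.toLinearMap
  let κ : T ≃L[ℂ] (Fin (Module.finrank ℂ T) → ℂ) :=
    (Module.finBasis ℂ T).equivFun.toContinuousLinearEquiv
  let ι : (Fin (Module.finrank ℂ T) → ℂ) →L[ℂ] E := T.subtypeL.comp κ.symm.toContinuousLinearMap
  let π : E →L[ℂ] (Fin (Module.finrank ℂ T) → ℂ) :=
    κ.toContinuousLinearMap.comp (G.proj.codRestrict T fun z => ⟨z, rfl⟩)
  have hι : ∀ t, G.proj (ι t) = ι t := by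
    intro t
    obtain ⟨z, hz⟩ := (κ.symm t).2
    change G.proj (κ.symm t : E) = (κ.symm t : E)
    rw [← hz]
    exact G.proj_proj z
  have hιπ : ∀ z, ι (π z) = G.proj z := by
    intro z
    change ((κ.symm (κ _) : T) : E) = _
    rw [κ.symm_apply_apply]
    rfl
  have hπι : ∀ t, π (ι t) = t := by
    intro t
    have : ι (π (ι t)) = ι t := by rw [hιπ, hι]
    exact κ.symm.injective (Subtype.ext this)
  have hπform : ∀ z w, π (G.form z w) = 0 := by
    intro z w
    have : ι (π (G.form z w)) = ι 0 := by rw [hιπ, G.proj_form, map_zero]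
    exact κ.symm.injective (Subtype.ext this)
  have hπf : ∀ t, π (ι t + (1 / 2 : ℂ) • G.form (ι t) (ι t)) = t := by
    intro t
    rw [map_add, map_smul, hπform, hπι, smul_zero, add_zero]
  have hd : ∀ t, HasFDerivAt (fun t => ι t + (1 / 2 : ℂ) • G.form (ι t) (ι t))
      (ι + (G.form (ι t)).comp ι) t := fun t =>
    ι.hasFDerivAt.add ((G.hasFDerivAt_form_self (ι t)).comp t ι.hasFDerivAt)
  refine ⟨Module.finrank ℂ T, Set.univ, fun t => ι t + (1 / 2 : ℂ) • G.form (ι t) (ι t),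
    ⟨isOpen_univ, trivial, fun t _ => (hd t).differentiableAt.differentiableWithinAt,
      fun t _ => ?_, fun s _ t _ hst => ?_, fun U _ hU => ⟨π ⁻¹' U, hU.preimage π.continuous, ?_⟩⟩,
    by simp⟩
  · rw [(hd t).fderiv]
    refine Function.LeftInverse.injective (g := π) fun b => ?_
    change π (ι b + G.form (ι t) (ι b)) = b
    rw [π.map_add, hπform, hπι, add_zero]
  · rw [← hπf s, ← hπf t]
    exact congrArg π hst
  · ext z
    constructor
    · rintro ⟨t, ht, rfl⟩
      exact ⟨G.add_form_mem_carrier (hι t), by simpa only [Set.mem_preimage, hπf] using ht⟩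
    · rintro ⟨hz, hzU⟩
      refine ⟨π z, hzU, ?_⟩
      simp only [hιπ]
      exact (G.eq_of_mem_carrier hz).symm

end

/-! ### Local parametrizations of the graph -/

section Param

variable {E : Type*} [NormedAddCommGroup E] [NormedSpace ℂ E] [FiniteDimensional ℂ E]
  {G : QuadraticGraph E} {d : ℕ} {W : Set (Fin d → ℂ)} {f : (Fin d → ℂ) → E}
  (hf : IsLocalParam G.carrier W f)
include hf

omit [FiniteDimensional ℂ E] in
theorem mem_carrier_of_isLocalParam {s : Fin d → ℂ} (hs : s ∈ W) : f s ∈ G.carrier := by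
  obtain ⟨O, -, hO⟩ := hf.relOpen W subset_rfl hf.isOpen
  exact (hO ▸ Set.mem_image_of_mem f hs : f s ∈ G.carrier ∩ O).1

omit [FiniteDimensional ℂ E] in
theorem hasFDerivAt_of_isLocalParam {s : Fin d → ℂ} (hs : s ∈ W) :
    HasFDerivAt f (fderiv ℂ f s) s :=
  (hf.holomorphic.differentiableAt (hf.isOpen.mem_nhds hs)).hasFDerivAt

omit [FiniteDimensional ℂ E] in
theorem fderiv_real_apply {s : Fin d → ℂ} (hs : s ∈ W) (b : Fin d → ℂ) :
    fderiv ℝ f s b = fderiv ℂ f s b := by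
  rw [((hasFDerivAt_of_isLocalParam hf hs).restrictScalars ℝ).fderiv]
  rfl

/-- The second derivative of a local parametrization. -/
theorem hasFDerivAt_fderiv_apply {s : Fin d → ℂ} (hs : s ∈ W) (b : Fin d → ℂ) :
    HasFDerivAt (fun s => fderiv ℂ f s b) (fderiv ℂ (fun s => fderiv ℂ f s b) s) s :=
  ((differentiableOn_fderiv_apply hf.isOpen hf.holomorphic b).differentiableAt
    (hf.isOpen.mem_nhds hs)).hasFDerivAt

theorem fderiv_real_fderiv_real_apply {s : Fin d → ℂ} (hs : s ∈ W) (a b : Fin d → ℂ) :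
    fderiv ℝ (fun s => fderiv ℝ f s b) s a = fderiv ℂ (fun s => fderiv ℂ f s b) s a := by
  have h : (fun s => fderiv ℝ f s b) =ᶠ[nhds s] fun s => fderiv ℂ f s b := by
    filter_upwards [hf.isOpen.mem_nhds hs] with s' hs'
    exact fderiv_real_apply hf hs' b
  rw [h.fderiv_eq, ((hasFDerivAt_fderiv_apply hf hs b).restrictScalars ℝ).fderiv]
  rfl

omit [FiniteDimensional ℂ E] in
theorem fderiv_sub_proj {s : Fin d → ℂ} (hs : s ∈ W) (b : Fin d → ℂ) :
    fderiv ℂ f s b - G.proj (fderiv ℂ f s b) = G.form (f s) (fderiv ℂ f s b) := by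
  have hd := hasFDerivAt_of_isLocalParam hf hs
  have h1 := hd.sub (G.proj.hasFDerivAt.comp s hd)
  have h2 := (G.hasFDerivAt_form_self (f s)).comp s hd
  have h3 : (fun s => f s - G.proj (f s)) =ᶠ[nhds s] fun s => (1 / 2 : ℂ) • G.form (f s) (f s) := by
    filter_upwards [hf.isOpen.mem_nhds hs] with s' hs'
    exact mem_carrier_of_isLocalParam hf hs'
  have h4 := h1.unique (h2.congr_of_eventuallyEq h3)
  exact congrArg (fun L : (Fin d → ℂ) →L[ℂ] E => L b) h4

theorem fderiv_fderiv_sub_proj {s : Fin d → ℂ} (hs : s ∈ W) (a b : Fin d → ℂ) :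
    fderiv ℂ (fun s => fderiv ℂ f s b) s a - G.proj (fderiv ℂ (fun s => fderiv ℂ f s b) s a)
      = G.form (fderiv ℂ f s a) (fderiv ℂ f s b)
        + G.form (f s) (fderiv ℂ (fun s => fderiv ℂ f s b) s a) := by
  have hd := hasFDerivAt_of_isLocalParam hf hs
  have hdd := hasFDerivAt_fderiv_apply hf hs b
  have h1 := hdd.sub (G.proj.hasFDerivAt.comp s hdd)
  have h2 := (G.form.hasFDerivAt.comp s hd).clm_apply hdd
  have h3 : (fun s => fderiv ℂ f s b - G.proj (fderiv ℂ f s b)) =ᶠ[nhds s]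
      fun s => G.form (f s) (fderiv ℂ f s b) := by
    filter_upwards [hf.isOpen.mem_nhds hs] with s' hs'
    exact fderiv_sub_proj hf hs' b
  have h4 := h1.unique (h2.congr_of_eventuallyEq h3)
  have h5 := congrArg (fun L : (Fin d → ℂ) →L[ℂ] E => L a) h4
  simp only [sub_apply, ContinuousLinearMap.comp_apply,
    add_apply, ContinuousLinearMap.flip_apply] at h5
  rw [h5, add_comm]
  rfl

/-- The domain of a local parametrization at the origin has full dimension: otherwise the
projection of its image, a neighbourhood of the origin, would have empty interior. -/
theorem finrank_range_proj_le (h0 : f 0 = 0) :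
    Module.finrank ℂ (LinearMap.range G.proj.toLinearMap) ≤ d := by
  by_contra hlt
  push Not at hlt
  let T : Submodule ℂ E := LinearMap.range G.proj.toLinearMap
  let P : E →L[ℂ] T := G.proj.codRestrict T fun z => ⟨z, rfl⟩
  obtain ⟨ε, hε, hεW⟩ := Metric.isOpen_iff.mp hf.isOpen 0 hf.zero_mem
  have hcd : ContDiffOn ℝ 1 (fun s => P (f s)) (Metric.ball 0 ε) := by
    have h1 : ContDiffOn ℂ 1 (fun s => P (f s)) (Metric.ball 0 ε) :=
      P.contDiff.comp_contDiffOn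
        ((contDiffOn_one_of_holomorphic hf.isOpen hf.holomorphic).mono hεW)
    exact h1.restrict_scalars ℝ
  have hdim : dimH (Metric.ball (0 : Fin d → ℂ) ε) < Module.finrank ℝ T := by
    refine (dimH_mono (Set.subset_univ _)).trans_lt ?_
    rw [Real.dimH_univ_eq_finrank, finrank_real_of_complex, finrank_real_of_complex]
    have h2 : Module.finrank ℂ (Fin d → ℂ) < Module.finrank ℂ T := by simpa using hlt
    exact_mod_cast (by omega : 2 * Module.finrank ℂ (Fin d → ℂ) < 2 * Module.finrank ℂ T)
  have hdense := hcd.dense_compl_image_of_dimH_lt_finrank (convex_ball _ _) subset_rfl hdim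
  obtain ⟨O, hO, hfO⟩ := hf.relOpen _ hεW Metric.isOpen_ball
  let Φ : T → E := fun u => (u : E) + (1 / 2 : ℂ) • G.form u u
  have hΦ : Continuous Φ := by
    have hc : Continuous fun u : T => (u : E) := continuous_subtype_val
    exact hc.add (((G.form.continuous.comp hc).clm_apply hc).const_smul _)
  have hproj : ∀ u : T, G.proj (u : E) = u := by
    rintro ⟨_, z, rfl⟩
    exact G.proj_proj z
  have h0O : (0 : T) ∈ Φ ⁻¹' O := by
    have h1 : f 0 ∈ f '' Metric.ball 0 ε := ⟨0, Metric.mem_ball_self hε, rfl⟩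
    rw [hfO, h0] at h1
    simpa [Φ] using h1.2
  obtain ⟨u, hu, huO⟩ := hdense.inter_open_nonempty _ (hO.preimage hΦ) ⟨0, h0O⟩
  refine huO ?_
  have h1 : Φ u ∈ f '' Metric.ball 0 ε := by
    rw [hfO]
    exact ⟨G.add_form_mem_carrier (hproj u), hu⟩
  obtain ⟨s, hs, hsu⟩ := h1
  refine ⟨s, hs, Subtype.ext ?_⟩
  change G.proj (f s) = u
  rw [hsu]
  simp only [Φ, map_add, map_smul, G.proj_form, hproj, smul_zero, add_zero]

/-- The tangent space of the graph in a local parametrization. -/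
theorem mem_range_fderiv_iff (h0 : f 0 = 0) {s : Fin d → ℂ} (hs : s ∈ W) (v : E) :
    v ∈ LinearMap.range (fderiv ℝ f s).toLinearMap ↔ v - G.proj v = G.form (f s) v := by
  constructor
  · rintro ⟨b, rfl⟩
    rw [ContinuousLinearMap.coe_coe, fderiv_real_apply hf hs]
    exact fderiv_sub_proj hf hs b
  · intro hv
    let T : Submodule ℂ E := LinearMap.range G.proj.toLinearMap
    let Q : (Fin d → ℂ) →ₗ[ℂ] T :=
      (G.proj.toLinearMap.codRestrict T fun z => ⟨z, rfl⟩) ∘ₗ (fderiv ℂ f s).toLinearMap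
    have hker : ∀ w : E, w - G.proj w = G.form (f s) w → G.proj w = 0 → w = 0 := by
      intro w hw hw0
      rw [← G.form_proj, hw0, map_zero, sub_zero] at hw
      exact hw
    have hQ : Function.Injective Q := by
      rw [← LinearMap.ker_eq_bot, LinearMap.ker_eq_bot']
      intro b hb
      have hb' : G.proj (fderiv ℂ f s b) = 0 := congrArg Subtype.val hb
      have := hker _ (fderiv_sub_proj hf hs b) hb'
      exact hf.immersion s hs (by rw [this, map_zero])
    have hfin : Module.finrank ℂ (Fin d → ℂ) = Module.finrank ℂ T := by
      refine le_antisymm (LinearMap.finrank_le_finrank_of_injective hQ) ?_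
      simpa using finrank_range_proj_le hf h0
    have hsurj := (LinearMap.injective_iff_surjective_of_finrank_eq_finrank hfin).mp hQ
    obtain ⟨b, hb⟩ := hsurj ⟨G.proj v, v, rfl⟩
    have hb' : G.proj (fderiv ℂ f s b) = G.proj v := congrArg Subtype.val hb
    refine ⟨b, ?_⟩
    rw [ContinuousLinearMap.coe_coe, fderiv_real_apply hf hs]
    have h := fderiv_sub_proj hf hs b
    have := hker (fderiv ℂ f s b - v)
      (by rw [map_sub, map_sub, ← h, ← hv]; abel) (by rw [map_sub, hb', sub_self])
    exact sub_eq_zero.mp this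

end Param

end QuadraticGraph

/-! ### Parallelism of the second fundamental form of a quadratic graph -/

section Normal

variable {E : Type*} [NormedAddCommGroup E] [NormedSpace ℝ E] {g : E → E → E → ℝ}

/-- For a definite metric the normal part, defined by choice, is determined by its defining
properties. -/
theorem normalPart_eq (hsub : ∀ z a b c, g z (a - b) c = g z a c - g z b c)
    (hdef : ∀ z a, g z a a = 0 → a = 0) {z : E} {T : Submodule ℝ E} {y n : E}
    (hn : ∀ t ∈ T, g z n t = 0) (hyn : y - n ∈ T) : normalPart g z T y = n := by
  have h : ∃ n : E, (∀ t ∈ T, g z n t = 0) ∧ y - n ∈ T := ⟨n, hn, hyn⟩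
  obtain ⟨h1, h2⟩ := Classical.epsilon_spec h
  change (∀ t ∈ T, g z (normalPart g z T y) t = 0) at h1
  change y - normalPart g z T y ∈ T at h2
  refine sub_eq_zero.mp (hdef z _ ?_)
  have h3 : normalPart g z T y - n ∈ T := by
    have := T.sub_mem hyn h2
    rwa [sub_sub_sub_cancel_left] at this
  rw [hsub, h1 _ h3, hn _ h3, sub_zero]

/-- For a definite metric the Christoffel map, defined by choice, is determined by the Koszul
formula. -/
theorem christoffel_eq (hsub : ∀ z a b c, g z (a - b) c = g z a c - g z b c)
    (hdef : ∀ z a, g z a a = 0 → a = 0) {z u v c : E}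
    (hc : ∀ w : E, 2 * g z c w = fderiv ℝ (fun y => g y v w) z u + fderiv ℝ (fun y => g y u w) z v
      - fderiv ℝ (fun y => g y u v) z w) : christoffel g z u v = c := by
  have h : ∀ w : E, 2 * g z (christoffel g z u v) w = fderiv ℝ (fun y => g y v w) z u
      + fderiv ℝ (fun y => g y u w) z v - fderiv ℝ (fun y => g y u v) z w :=
    Classical.epsilon_spec (p := fun c : E => ∀ w : E, 2 * g z c w =
      fderiv ℝ (fun y => g y v w) z u + fderiv ℝ (fun y => g y u w) z v
      - fderiv ℝ (fun y => g y u v) z w) ⟨c, hc⟩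
  refine sub_eq_zero.mp (hdef z _ ?_)
  rw [hsub]
  linarith [h (christoffel g z u v - c), hc (christoffel g z u v - c)]

end Normal

namespace QuadraticGraph

variable {E : Type*} [NormedAddCommGroup E] [NormedSpace ℂ E] [FiniteDimensional ℂ E]
  {G : QuadraticGraph E} {d : ℕ} {W : Set (Fin d → ℂ)} {f : (Fin d → ℂ) → E}

/-- The sum of a map `ν z`, whose values are normal to the graph at `z`, and of the map
`proj + form z` onto the tangent space of the graph at `z`. If `ν 0 = 1 - proj` then this is the
identity at the origin, hence invertible nearby. -/
noncomputable def frame (G : QuadraticGraph E) (ν : E → E →L[ℝ] E) (z : E) : E →L[ℝ] E :=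
  ν z + (G.proj + G.form z).restrictScalars ℝ

omit [FiniteDimensional ℂ E] in
theorem frame_apply (ν : E → E →L[ℝ] E) (z y : E) :
    G.frame ν z y = ν z y + (G.proj y + G.form z y) := rfl

/-- The second fundamental form of the graph: the second derivative of a parametrization equals
`form (df b) (df c)` up to tangent vectors, and the Christoffel terms are tangent because tangent
spaces are complex. The normal part is computed in a frame consisting of the tangent frame and of
the normal frame `ν`. -/
theorem secondFF_eq (hf : IsLocalParam G.carrier W f) (h0 : f 0 = 0) {g : E → E → E → ℝ}
    (hsub : ∀ z a b c, g z (a - b) c = g z a c - g z b c) (hdef : ∀ z a, g z a a = 0 → a = 0)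
    {θ : E → E → ℂ} (hΓ : ∀ z u v, christoffel g z u v = -(θ z u • v + θ z v • u))
    {ν : E → E →L[ℝ] E}
    (hν : ∀ z ∈ G.carrier, ∀ y t, t - G.proj t = G.form z t → g z (ν z y) t = 0)
    {s : Fin d → ℂ} (hs : s ∈ W) (hA : IsUnit (G.frame ν (f s))) (b c : Fin d → ℂ) :
    secondFF g f s b c
      = ν (f s) (Ring.inverse (G.frame ν (f s)) (G.form (fderiv ℂ f s b) (fderiv ℂ f s c))) ∧
    secondFF g f s b c - G.form (fderiv ℂ f s b) (fderiv ℂ f s c)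
      - G.proj (secondFF g f s b c - G.form (fderiv ℂ f s b) (fderiv ℂ f s c))
      = G.form (f s) (secondFF g f s b c) := by
  set β := G.form (fderiv ℂ f s b) (fderiv ℂ f s c) with hβ
  set η := Ring.inverse (G.frame ν (f s)) β with hη
  have hAη : ν (f s) η + (G.proj η + G.form (f s) η) = β := by
    rw [← frame_apply]
    have := congrArg (fun L : E →L[ℝ] E => L β) (Ring.mul_inverse_cancel _ hA)
    exact this
  have hmain : secondFF g f s b c = ν (f s) η := by
    refine normalPart_eq hsub hdef (fun t ht => ?_) ?_
    · exact hν _ (mem_carrier_of_isLocalParam hf hs) η t ((mem_range_fderiv_iff hf h0 hs t).mp ht)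
    · rw [mem_range_fderiv_iff hf h0 hs, covDeriv, hΓ, fderiv_real_fderiv_real_apply hf hs,
        fderiv_real_apply hf hs, fderiv_real_apply hf hs]
      have h1 := fderiv_fderiv_sub_proj hf hs b c
      have h2 := fderiv_sub_proj hf hs b
      have h3 := fderiv_sub_proj hf hs c
      have h4 : ν (f s) η = β - (G.proj η + G.form (f s) η) := by rw [← hAη]; abel
      rw [← hβ] at h1
      have hβP : G.proj β = 0 := G.proj_form _ _
      have hβF : ∀ z, G.form z β = 0 := fun z => G.form_form _ _ _
      rw [h4]
      simp only [map_add, map_sub, map_neg, map_smul, G.proj_proj, G.proj_form, hβP, hβF,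
        G.form_form, G.form_proj]
      linear_combination (norm := module) h1 - θ (f s) (fderiv ℂ f s b) • h3
        - θ (f s) (fderiv ℂ f s c) • h2
  refine ⟨hmain, ?_⟩
  have h4 : secondFF g f s b c - β = -(G.proj η + G.form (f s) η) := by
    rw [hmain, ← hAη]; abel
  have h5 : secondFF g f s b c = β - (G.proj η + G.form (f s) η) := by
    rw [hmain, ← hAη]; abel
  rw [h4, h5, map_sub, hβ, G.form_form]
  simp only [map_add, map_neg, G.proj_proj, G.proj_form, G.form_form, G.form_proj]
  module

/-- The second fundamental form of a quadratic graph is parallel at the origin, provided that the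
ambient metric has Christoffel map `-(θ(u) v + θ(v) u)` with `θ = 0` at the origin and admits a
normal frame `ν` along the graph with `ν = 1 - proj` at the origin. Write `α` for the second
fundamental form and `β(b, c) = form (df b) (df c)`. Then `α - β` is tangent, so its component in
`ker proj` is `form f α`, whose derivative at the origin vanishes; hence `∇^⊥ α` is the derivative
of `β`, and this is cancelled by the terms with the induced connection. -/
theorem derivSecondFF_eq_zero (hf : IsLocalParam G.carrier W f) (h0 : f 0 = 0)
    {g : E → E → E → ℝ}
    (hsub : ∀ z a b c, g z (a - b) c = g z a c - g z b c) (hdef : ∀ z a, g z a a = 0 → a = 0)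
    {θ : E → E → ℂ} (hΓ : ∀ z u v, christoffel g z u v = -(θ z u • v + θ z v • u))
    (hθ : ∀ u, θ 0 u = 0) {ν : E → E →L[ℝ] E}
    (hν : ∀ z ∈ G.carrier, ∀ y t, t - G.proj t = G.form z t → g z (ν z y) t = 0)
    (hνd : DifferentiableAt ℝ ν 0) (hν0 : ∀ y, ν 0 y = y - G.proj y) (a b c : Fin d → ℂ) :
    derivSecondFF g f 0 a b c = 0 := by
  have : CompleteSpace E := FiniteDimensional.complete ℂ E
  have hW := hf.zero_mem
  have hWn : ∀ᶠ s in nhds 0, s ∈ W := hf.isOpen.mem_nhds hW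
  have hfd : HasFDerivAt f ((fderiv ℂ f 0).restrictScalars ℝ) 0 :=
    (hasFDerivAt_of_isLocalParam hf hW).restrictScalars ℝ
  -- differentiability of the frame along the parametrization
  have hνf : DifferentiableAt ℝ (fun s => ν (f s)) 0 :=
    DifferentiableAt.comp 0 (by rw [h0]; exact hνd) hfd.differentiableAt
  have hfr : DifferentiableAt ℝ (fun s => G.frame ν (f s)) 0 := by
    have h1 : DifferentiableAt ℝ (fun s => G.form (f s)) 0 :=
      ((G.form.restrictScalars ℝ).differentiableAt (x := f 0)).comp 0 hfd.differentiableAt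
    have h2 : DifferentiableAt ℝ (fun s => (G.proj + G.form (f s)).restrictScalars ℝ) 0 :=
      ((ContinuousLinearMap.restrictScalarsL ℂ E E ℝ ℝ).differentiableAt).comp 0
        (h1.const_add G.proj)
    exact hνf.add h2
  have hfr0 : G.frame ν (f 0) = 1 := by
    ext y
    rw [frame_apply, h0, hν0]
    simp
  have hunit : ∀ᶠ s in nhds 0, IsUnit (G.frame ν (f s)) := by
    have : {A : E →L[ℝ] E | IsUnit A} ∈ nhds (G.frame ν (f 0)) :=
      Units.isOpen.mem_nhds (by rw [hfr0]; exact isUnit_one)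
    exact hfr.continuousAt.eventually this
  have hgood : ∀ᶠ s in nhds 0, s ∈ W ∧ IsUnit (G.frame ν (f s)) := hWn.and hunit
  have hSF := fun {s : Fin d → ℂ} (hs : s ∈ W ∧ IsUnit (G.frame ν (f s))) (b c : Fin d → ℂ) =>
    secondFF_eq hf h0 hsub hdef hΓ hν hs.1 hs.2 b c
  have hSF0 : ∀ b c, secondFF g f 0 b c = G.form (fderiv ℂ f 0 b) (fderiv ℂ f 0 c) := by
    intro b c
    rw [(hSF hgood.self_of_nhds b c).1, hfr0, Ring.inverse_one, h0, hν0]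
    simp [G.proj_form]
  have hsecond : ∀ b, HasFDerivAt (fun s => fderiv ℂ f s b)
      ((fderiv ℂ (fun s => fderiv ℂ f s b) 0).restrictScalars ℝ) 0 := fun b =>
    (hasFDerivAt_fderiv_apply hf hW b).restrictScalars ℝ
  set D₂ : (Fin d → ℂ) → (Fin d → ℂ) → E := fun a b => fderiv ℂ (fun s => fderiv ℂ f s b) 0 a
    with hD₂
  -- the derivative of `β`
  obtain ⟨β', hβ', hβ'a⟩ : ∃ β' : (Fin d → ℂ) →L[ℝ] E,
      HasFDerivAt (fun s => G.form (fderiv ℂ f s b) (fderiv ℂ f s c)) β' 0 ∧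
      β' a = G.form (D₂ a b) (fderiv ℂ f 0 c) + G.form (fderiv ℂ f 0 b) (D₂ a c) := by
    have h1 : HasFDerivAt (fun s => G.form (fderiv ℂ f s b) (fderiv ℂ f s c)) _ 0 :=
      (G.form.hasFDerivAt.comp 0 (hasFDerivAt_fderiv_apply hf hW b)).clm_apply
        (hasFDerivAt_fderiv_apply hf hW c)
    refine ⟨_, h1.restrictScalars ℝ, ?_⟩
    simp only [ContinuousLinearMap.coe_restrictScalars', add_apply,
      ContinuousLinearMap.comp_apply, ContinuousLinearMap.flip_apply, hD₂]
    exact add_comm _ _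
  -- the derivative of the second fundamental form
  have hα : DifferentiableAt ℝ (fun s => secondFF g f s b c) 0 := by
    have hinv : DifferentiableAt ℝ (fun s => Ring.inverse (G.frame ν (f s))) 0 := by
      refine DifferentiableAt.comp (g := Ring.inverse) 0 ?_ hfr
      rw [hfr0]
      exact differentiableAt_inverse (𝕜 := ℝ) (1 : (E →L[ℝ] E)ˣ).isUnit
    refine (hνf.clm_apply (hinv.clm_apply hβ'.differentiableAt)).congr_of_eventuallyEq ?_
    filter_upwards [hgood] with s hs
    exact (hSF hs b c).1
  set α' := fderiv ℝ (fun s => secondFF g f s b c) 0 with hα'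
  have hαd : HasFDerivAt (fun s => secondFF g f s b c) α' 0 := hα.hasFDerivAt
  have hαβ : α' a - β' a - G.proj (α' a - β' a) = 0 := by
    have h1 := (hαd.sub hβ').sub ((G.proj.restrictScalars ℝ).hasFDerivAt.comp 0 (hαd.sub hβ'))
    have h2 := (((ContinuousLinearMap.restrictScalarsL ℂ E E ℝ ℝ).hasFDerivAt.comp 0
      (((G.form.restrictScalars ℝ).hasFDerivAt (x := f 0)).comp 0 hfd))).clm_apply hαd
    have h3 : (fun s => secondFF g f s b c - G.form (fderiv ℂ f s b) (fderiv ℂ f s c)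
        - G.proj (secondFF g f s b c - G.form (fderiv ℂ f s b) (fderiv ℂ f s c)))
        =ᶠ[nhds 0] fun s => G.form (f s) (secondFF g f s b c) := by
      filter_upwards [hgood] with s hs
      exact (hSF hs b c).2
    have h4 := h1.unique (h2.congr_of_eventuallyEq h3)
    have h5 := congrArg (fun L : (Fin d → ℂ) →L[ℝ] E => L a) h4
    have h6 : α' a - β' a - G.proj (α' a - β' a)
        = G.form (f 0) (α' a) + G.form (fderiv ℂ f 0 a) (secondFF g f 0 b c) := h5
    rw [h6, h0, hSF0, G.form_form, map_zero]
    simp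
  have hβP : G.proj (β' a) = 0 := by
    rw [hβ'a, map_add, G.proj_form, G.proj_form, add_zero]
  -- the three terms of `∇ α`
  have hΓ0 : ∀ u v, christoffel g (f 0) u v = 0 := by
    intro u v
    rw [hΓ, h0, hθ, hθ]
    simp
  have hnormal : normalDeriv g f (fun s => secondFF g f s b c) 0 a = β' a := by
    rw [normalDeriv, hΓ0, add_zero, ← hα']
    have h1 : α' a - G.proj (α' a) = β' a := by
      rw [map_sub, hβP, sub_zero] at hαβ
      linear_combination (norm := module) hαβ
    rw [← h1]
    refine normalPart_eq hsub hdef (fun t ht => ?_) ?_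
    · rw [← hν0, h0]
      rw [mem_range_fderiv_iff hf h0 hW, h0] at ht
      exact hν 0 (by simp [mem_carrier]) _ t ht
    · rw [mem_range_fderiv_iff hf h0 hW, sub_sub_cancel, G.proj_proj, h0]
      simp
  have hconn : ∀ b c, secondFF g f 0 (inducedConn g f 0 a b) c
      = G.form (D₂ a b) (fderiv ℂ f 0 c) := by
    intro b c
    have hcov : covDeriv g f 0 a b - secondFF g f 0 a b
        = D₂ a b - G.form (fderiv ℂ f 0 a) (fderiv ℂ f 0 b) := by
      rw [covDeriv, hΓ0, hSF0, fderiv_real_fderiv_real_apply hf hW, add_zero]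
    have hmem : covDeriv g f 0 a b - secondFF g f 0 a b
        ∈ LinearMap.range (fderiv ℝ f 0).toLinearMap := by
      have h1 := fderiv_fderiv_sub_proj hf hW a b
      rw [hcov, mem_range_fderiv_iff hf h0 hW, map_sub, G.proj_form, map_sub, G.form_form]
      linear_combination (norm := module) h1
    have hspec : fderiv ℝ f 0 (inducedConn g f 0 a b)
        = covDeriv g f 0 a b - secondFF g f 0 a b := by
      obtain ⟨x, hx⟩ := hmem
      exact Classical.epsilon_spec (p := fun c => fderiv ℝ f 0 c
        = covDeriv g f 0 a b - secondFF g f 0 a b) ⟨x, hx⟩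
    rw [hSF0, ← fderiv_real_apply hf hW (inducedConn g f 0 a b), hspec, hcov, map_sub,
      sub_apply, G.form_form_left, sub_zero]
  have hsymm : ∀ b c, secondFF g f 0 b c = secondFF g f 0 c b := fun b c => by
    rw [hSF0, hSF0, G.form_comm]
  rw [derivSecondFF, hnormal, hconn, hsymm b, hconn, hβ'a, G.form_comm (fderiv ℂ f 0 b)]
  abel

end QuadraticGraph

end ChartGeometry

namespace PosHermJordanTriple

/-! ### The Levi-Civita connection of the Fubini-Study metric -/

section FubiniStudy

variable {V : Type*} [NormedAddCommGroup V] [NormedSpace ℂ V]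
  {J : PosHermJordanTriple V} {x : V}

theorem herm_add_perp_self_ne_zero (hx : x ≠ 0) (z : J.perp x) :
    J.herm (x + z) (x + z) ≠ 0 :=
  J.herm_self_ne_zero (J.add_perp_ne_zero hx z)

theorem fubiniStudy_sub_left (z a b c : J.perp x) :
    J.fubiniStudy x z (a - b) c = J.fubiniStudy x z a c - J.fubiniStudy x z b c := by
  simp only [fubiniStudy, Submodule.coe_sub, herm_sub_left, ← Complex.sub_re]
  congr 1
  ring

/-- The Fubini-Study metric is definite: this is the equality case of the Cauchy-Schwarz
inequality, together with the fact that no nonzero multiple of `x + z` is orthogonal to `x`. -/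
theorem eq_zero_of_fubiniStudy_self (hx : x ≠ 0) (z a : J.perp x)
    (h : J.fubiniStudy x z a a = 0) : a = 0 := by
  set y := x + (z : V) with hy
  have hN := herm_add_perp_self_ne_zero hx z
  rw [← hy] at hN
  set c := J.herm (a : V) y / J.herm y y with hc
  have hNr : starRingEnd ℂ (J.herm y y) = J.herm y y := J.herm_conj y y
  have key : J.herm (a - c • y) (a - c • y) = J.herm y y *
      (J.herm (a : V) a / J.herm y y
        - J.herm (a : V) y * J.herm y (a : V) / J.herm y y ^ 2) := by
    simp only [herm_sub_left, herm_sub_right, herm_smul_left, herm_smul_right, hc, map_div₀, hNr,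
      J.herm_conj]
    field_simp
    ring
  have h1 : (J.herm (a - c • y) (a - c • y)).re = 0 := by
    rw [key, J.herm_self_ofReal y, Complex.re_ofReal_mul, ← J.herm_self_ofReal y]
    have : (J.herm (a : V) a / J.herm y y
        - J.herm (a : V) y * J.herm y (a : V) / J.herm y y ^ 2).re = 0 := h
    rw [this, mul_zero]
  have h2 : (a : V) - c • y = 0 := by
    by_contra hne
    exact (J.herm_self_pos hne).ne' h1
  have hax : J.herm (a : V) x = 0 := a.2
  have hzx : J.herm (z : V) x = 0 := z.2
  have h3 : c * J.herm x x = 0 := by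
    have := congrArg (fun v => J.herm v x) h2
    simp only [herm_sub_left, herm_smul_left, hax, hy, herm_add_left, hzx, herm_zero_left] at this
    linear_combination -this
  have h4 : c = 0 := (mul_eq_zero.mp h3).resolve_right (J.herm_self_ne_zero hx)
  rw [h4, zero_smul, sub_zero] at h2
  exact Subtype.ext h2

variable [FiniteDimensional ℂ V]

theorem differentiable_fubiniStudy (hx : x ≠ 0) (v w : J.perp x) :
    Differentiable ℝ fun z => J.fubiniStudy x z v w := by
  intro z
  have hY : Differentiable ℝ fun z : J.perp x => x + (z : V) :=
    ((J.perp x).subtypeL.restrictScalars ℝ).differentiable.const_add x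
  have hN : Differentiable ℝ fun z : J.perp x => J.herm (x + z) (x + z) :=
    (J.hermL.differentiable.comp hY).clm_apply hY
  have hq : Differentiable ℝ fun z : J.perp x => J.herm (v : V) (x + z) :=
    (J.hermL (v : V)).differentiable.comp hY
  have hp : Differentiable ℝ fun z : J.perp x => J.herm (x + z) (w : V) :=
    (J.hermL.differentiable.comp hY).clm_apply (differentiable_const (w : V))
  have hne : ∀ z : J.perp x, J.herm (x + z) (x + z) ≠ 0 := herm_add_perp_self_ne_zero hx
  have h : Differentiable ℝ fun z : J.perp x => J.herm (v : V) w / J.herm (x + z) (x + z)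
      - J.herm (v : V) (x + z) * J.herm (x + z) (w : V) / J.herm (x + z) (x + z) ^ 2 := by
    simp only [div_eq_mul_inv]
    exact ((differentiable_const _).mul (hN.inv hne)).sub
      ((hq.mul hp).mul ((hN.pow 2).inv fun z => pow_ne_zero 2 (hne z)))
  exact (Complex.reCLM.differentiable.comp h) z

theorem fderiv_fubiniStudy (hx : x ≠ 0) (z u v w : J.perp x) :
    fderiv ℝ (fun z => J.fubiniStudy x z v w) z u
      = (-(J.herm (v : V) w * (J.herm (u : V) (x + z) + J.herm (x + z) (u : V)))
            / J.herm (x + z) (x + z) ^ 2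
          - (J.herm (v : V) u * J.herm (x + z) (w : V) + J.herm (v : V) (x + z) * J.herm (u : V) w)
            / J.herm (x + z) (x + z) ^ 2
          + 2 * J.herm (v : V) (x + z) * J.herm (x + z) (w : V)
            * (J.herm (u : V) (x + z) + J.herm (x + z) (u : V))
            / J.herm (x + z) (x + z) ^ 3).re := by
  have hline : HasDerivAt (fun t : ℝ => z + t • u) u 0 := by
    simpa using ((hasDerivAt_id (0 : ℝ)).smul_const u).const_add z
  have h1 : HasDerivAt (fun t : ℝ => J.fubiniStudy x (z + t • u) v w)
      (fderiv ℝ (fun z => J.fubiniStudy x z v w) z u) 0 := by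
    have h := (differentiable_fubiniStudy hx v w (z + (0 : ℝ) • u)).hasFDerivAt.comp_hasDerivAt
      (0 : ℝ) hline
    simpa [Function.comp_def] using h
  have hY : HasDerivAt (fun t : ℝ => x + ((z + t • u : J.perp x) : V)) (u : V) 0 :=
    (((J.perp x).subtypeL.restrictScalars ℝ).hasFDerivAt.comp_hasDerivAt (0 : ℝ) hline).const_add x
  have hHY : HasDerivAt (fun t : ℝ => J.hermL (x + ((z + t • u : J.perp x) : V)))
      (J.hermL (u : V)) 0 :=
    J.hermL.hasFDerivAt.comp_hasDerivAt (0 : ℝ) hY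
  have hN : HasDerivAt (fun t : ℝ => J.herm (x + ((z + t • u : J.perp x) : V))
      (x + ((z + t • u : J.perp x) : V))) (J.herm (u : V) (x + z) + J.herm (x + z) (u : V)) 0 := by
    exact (hHY.clm_apply hY).congr_deriv (by simp [herm_add_left])
  have hq : HasDerivAt (fun t : ℝ => J.herm (v : V) (x + ((z + t • u : J.perp x) : V)))
      (J.herm (v : V) u) 0 :=
    (J.hermL (v : V)).hasFDerivAt.comp_hasDerivAt (0 : ℝ) hY
  have hp : HasDerivAt (fun t : ℝ => J.herm (x + ((z + t • u : J.perp x) : V)) (w : V))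
      (J.herm (u : V) w) 0 := by
    exact (hHY.clm_apply (hasDerivAt_const (0 : ℝ) (w : V))).congr_deriv (by simp)
  have hne := herm_add_perp_self_ne_zero hx (z + (0 : ℝ) • u)
  have hne' := herm_add_perp_self_ne_zero hx z
  have h2 := ((hasDerivAt_const (0 : ℝ) (J.herm (v : V) w)).div hN hne).sub
    ((hq.mul hp).div (hN.pow 2) (pow_ne_zero 2 hne))
  have h3 := Complex.reCLM.hasFDerivAt.comp_hasDerivAt (0 : ℝ) h2
  rw [h1.unique h3, Complex.reCLM_apply]
  congr 1
  simp only [zero_smul, add_zero, Pi.pow_apply, Pi.mul_apply]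
  field_simp
  ring

/-- The Christoffel map of the Fubini-Study metric in an affine chart: the connection is
holomorphically projectively flat, with the form `θ(u) = (u | x + z) / (x + z | x + z)`. -/
theorem christoffel_fubiniStudy (hx : x ≠ 0) (z u v : J.perp x) :
    ChartGeometry.christoffel (J.fubiniStudy x) z u v
      = -((J.herm (u : V) (x + z) / J.herm (x + z) (x + z)) • v
        + (J.herm (v : V) (x + z) / J.herm (x + z) (x + z)) • u) := by
  refine ChartGeometry.christoffel_eq fubiniStudy_sub_left
    (eq_zero_of_fubiniStudy_self hx) fun w => ?_
  rw [fderiv_fubiniStudy hx, fderiv_fubiniStudy hx, fderiv_fubiniStudy hx, fubiniStudy]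
  have hN := herm_add_perp_self_ne_zero hx z
  set y := x + (z : V) with hy
  have hNr : starRingEnd ℂ (J.herm y y) = J.herm y y := J.herm_conj y y
  -- the two sides differ by `conj Z - Z`
  set Z := (J.herm (u : V) y * J.herm (w : V) v + J.herm (u : V) v * J.herm (w : V) y)
      / J.herm y y ^ 2
    - 2 * J.herm (u : V) y * J.herm y (v : V) * J.herm (w : V) y / J.herm y y ^ 3 with hZ
  have hZc : starRingEnd ℂ Z
      = (J.herm y (u : V) * J.herm (v : V) w + J.herm (v : V) u * J.herm y (w : V))
        / J.herm y y ^ 2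
      - 2 * J.herm y (u : V) * J.herm (v : V) y * J.herm y (w : V) / J.herm y y ^ 3 := by
    rw [hZ]
    simp only [map_sub, map_add, map_mul, map_div₀, map_pow, J.herm_conj, map_ofNat]
  have hre : (starRingEnd ℂ Z - Z).re = 0 := by simp
  have h2 : ∀ a : ℂ, 2 * a.re = (2 * a).re := fun a => by simp
  rw [h2, ← Complex.add_re, ← Complex.sub_re, ← sub_zero (Complex.re _), ← hre, ← Complex.sub_re,
    hZc, hZ]
  congr 1
  simp only [Submodule.coe_neg, Submodule.coe_add, Submodule.coe_smul, herm_neg_left,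
    herm_add_left, herm_smul_left]
  field_simp
  ring

end FubiniStudy

/-! ### The first characteristic variety in an affine chart -/

section ChartGraph

variable {V : Type*} [NormedAddCommGroup V] [NormedSpace ℂ V] [FiniteDimensional ℂ V]
  {J : PosHermJordanTriple V} {e : V} (he : J.IsPrimitive e) {r : ℝ} (hr : 0 < r)

include hr in
omit [FiniteDimensional ℂ V] in
theorem mem_perp_ofReal_smul {z : V} : z ∈ J.perp ((r : ℂ) • e) ↔ J.herm z e = 0 :=
  perp_smul (by exact_mod_cast hr.ne')

/-- `D(e, e)` on the orthogonal complement of `e`. -/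
noncomputable def perpD : J.perp ((r : ℂ) • e) →L[ℂ] J.perp ((r : ℂ) • e) :=
  ((J.D e e).restrict (p := J.perp ((r : ℂ) • e)) (q := J.perp ((r : ℂ) • e)) fun z hz => by
    rw [mem_perp_ofReal_smul hr] at hz ⊢
    rw [herm_adjoint, J.isTripotent_iff.mp he.1, herm_smul_right, hz,
      mul_zero]).toContinuousLinearMap

/-- The bilinear map `(z, w) ↦ r⁻¹ {z e w}` on the orthogonal complement of `e`. -/
noncomputable def perpForm :
    J.perp ((r : ℂ) • e) →L[ℂ] J.perp ((r : ℂ) • e) →L[ℂ] J.perp ((r : ℂ) • e) :=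
  (LinearMap.mk₂ ℂ (fun z w : J.perp ((r : ℂ) • e) =>
    (⟨((r : ℂ)⁻¹) • J.D z e w, by
      have hw := (mem_perp_ofReal_smul hr).mp w.2
      obtain ⟨c, hc⟩ := he.isRankOne z
      rw [mem_perp_ofReal_smul hr, herm_smul_left, herm_adjoint, hc, herm_smul_right, hw]
      simp⟩ : J.perp ((r : ℂ) • e)))
    (fun _ _ _ => Subtype.ext (by simp))
    (fun c _ _ => Subtype.ext (by simp [smul_comm c]))
    (fun _ _ _ => Subtype.ext (by simp))
    (fun c _ _ => Subtype.ext (by simp [smul_comm c]))).toContinuousBilinearMap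

theorem perpForm_coe (z w : J.perp ((r : ℂ) • e)) :
    (perpForm he hr z w : V) = (r : ℂ)⁻¹ • J.D (z : V) e w := rfl

theorem perpProj_coe_of_eq_add {z : J.perp ((r : ℂ) • e)} {u w : V} (hu : u ∈ J.peirce e 1)
    (hw : w ∈ J.peirce e 0) (hz : (z : V) = u + w) :
    (((2 : ℂ) • perpD he hr - perpD he hr ∘L perpD he hr) z : V) = u := by
  change (2 : ℂ) • J.D e e (z : V) - J.D e e (J.D e e (z : V)) = u
  rw [mem_peirce] at hu hw
  simp only [hz, map_add, hu, hw, one_smul, zero_smul, add_zero]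
  module

include hr he in
theorem exists_perp_decomp (z : J.perp ((r : ℂ) • e)) :
    ∃ u ∈ J.peirce e 1, ∃ w ∈ J.peirce e 0, (z : V) = u + w :=
  exists_decomp_of_herm_eq_zero he ((mem_perp_ofReal_smul hr).mp z.2)

omit [FiniteDimensional ℂ V] in
theorem D_tripotent_of_add (he : J.IsTripotent e) {u w u' w' : V} (hu : u ∈ J.peirce e 1)
    (hw : w ∈ J.peirce e 0) (hw' : w' ∈ J.peirce e 0) :
    J.D (u + w) e (u' + w') = J.D u e u' := by
  have h1 : J.D w e = 0 := D_zero_two he hw (self_mem_peirce he)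
  rw [map_add J.D, LinearMap.add_apply, h1, add_zero, map_add, D_one_tripotent_zero he hu hw',
    add_zero]

/-- The first characteristic variety in the affine chart centred at `[r e]`, as the graph of
the quadratic map `u ↦ ½ r⁻¹ {u e u}` from `V₁(e)` to `V₀(e)`. -/
noncomputable def chartGraph : ChartGeometry.QuadraticGraph (J.perp ((r : ℂ) • e)) where
  proj := (2 : ℂ) • perpD he hr - perpD he hr ∘L perpD he hr
  form := perpForm he hr
  proj_proj z := by
    obtain ⟨u, hu, w, hw, hz⟩ := exists_perp_decomp he hr z
    have h1 := perpProj_coe_of_eq_add he hr hu hw hz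
    refine Subtype.ext ?_
    rw [perpProj_coe_of_eq_add he hr hu (zero_mem _) (by rw [h1, add_zero]), h1]
  form_comm z w := Subtype.ext (by rw [perpForm_coe, perpForm_coe, J.symm])
  form_proj z z' := by
    obtain ⟨u, hu, w, hw, hz⟩ := exists_perp_decomp he hr z
    obtain ⟨u', hu', w', hw', hz'⟩ := exists_perp_decomp he hr z'
    have h1 := perpProj_coe_of_eq_add he hr hu' hw' hz'
    refine Subtype.ext ?_
    rw [perpForm_coe, perpForm_coe, h1, hz, hz', D_tripotent_of_add he.1 hu hw hw',
      ← add_zero u', D_tripotent_of_add he.1 hu hw (zero_mem _), add_zero]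
  proj_form z z' := by
    obtain ⟨u, hu, w, hw, hz⟩ := exists_perp_decomp he hr z
    obtain ⟨u', hu', w', hw', hz'⟩ := exists_perp_decomp he hr z'
    have h1 : J.D (z : V) e z' ∈ J.peirce e 0 := by
      rw [hz, hz', D_tripotent_of_add he.1 hu hw hw']
      exact D_one_tripotent_one he.1 hu hu'
    refine Subtype.ext ?_
    exact perpProj_coe_of_eq_add he hr (zero_mem _) (Submodule.smul_mem _ (r : ℂ)⁻¹ h1)
      (by rw [perpForm_coe, Submodule.coe_zero, zero_add])

theorem chartGraph_proj_coe {z : J.perp ((r : ℂ) • e)} {u w : V} (hu : u ∈ J.peirce e 1)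
    (hw : w ∈ J.peirce e 0) (hz : (z : V) = u + w) : ((chartGraph he hr).proj z : V) = u :=
  perpProj_coe_of_eq_add he hr hu hw hz

theorem chartGraph_form_coe (z w : J.perp ((r : ℂ) • e)) :
    ((chartGraph he hr).form z w : V) = (r : ℂ)⁻¹ • J.D (z : V) e w := rfl

theorem chartGraph_proj_eq_iff (z : J.perp ((r : ℂ) • e)) :
    (chartGraph he hr).proj z = z ↔ (z : V) ∈ J.peirce e 1 := by
  obtain ⟨u, hu, w, hw, hz⟩ := exists_perp_decomp he hr z
  have h1 := chartGraph_proj_coe he hr hu hw hz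
  constructor
  · intro h
    rw [← h, h1]; exact hu
  · intro h
    exact Subtype.ext (chartGraph_proj_coe he hr h (zero_mem _) (by rw [add_zero]))

theorem preimage_chart_eq (hx : (r : ℂ) • e ≠ 0) :
    J.chart hx ⁻¹' J.mokVariety 1 = (chartGraph he hr).carrier := by
  ext z
  obtain ⟨u, hu, w, hw, hz⟩ := exists_perp_decomp he hr z
  have h1 := chartGraph_proj_coe he hr hu hw hz
  rw [Set.mem_preimage, chart, mk_mem_mokVariety_iff, hz,
    isRankOne_smul_add_iff he hu hw (by exact_mod_cast hr.ne'),
    ChartGeometry.QuadraticGraph.mem_carrier, Subtype.ext_iff, Submodule.coe_sub,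
    Submodule.coe_smul, chartGraph_form_coe, h1, hz, D_tripotent_of_add he.1 hu hw hw,
    add_sub_cancel_left]

end ChartGraph

/-! ### A normal frame along the characteristic variety -/

section Normal

variable {V : Type*} [NormedAddCommGroup V] [NormedSpace ℂ V] [FiniteDimensional ℂ V]
  {J : PosHermJordanTriple V} {e : V} (he : J.IsPrimitive e) {r : ℝ} (hr : 0 < r)

/-- The bilinear map `(z, y) ↦ r⁻¹ {e u w}`, where `u` is the component of `z` in `V₁(e)` and `w`
the component of `y` in `V₀(e)`. -/
noncomputable def perpCoForm :
    J.perp ((r : ℂ) • e) →L[ℝ] J.perp ((r : ℂ) • e) →L[ℝ] J.perp ((r : ℂ) • e) :=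
  (LinearMap.mk₂ ℝ (fun z y : J.perp ((r : ℂ) • e) =>
    (⟨(r : ℂ)⁻¹ • J.D e ((chartGraph he hr).proj z) (y - (chartGraph he hr).proj y), by
      obtain ⟨u, hu, w, hw, hz⟩ := exists_perp_decomp he hr z
      obtain ⟨u', hu', w', hw', hy⟩ := exists_perp_decomp he hr y
      rw [chartGraph_proj_coe he hr hu hw hz, chartGraph_proj_coe he hr hu' hw' hy, hy,
        add_sub_cancel_left, mem_perp_ofReal_smul hr, herm_smul_left, herm_adjoint, J.symm,
        J.mem_peirce.mp hu, one_smul, J.herm_peirce (map_one _) zero_ne_one hw' hu,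
        mul_zero]⟩ : J.perp ((r : ℂ) • e)))
    (fun _ _ _ => Subtype.ext (by simp))
    (fun c _ _ => Subtype.ext (by simp [← Complex.coe_smul, smul_comm (c : ℂ)]))
    (fun _ _ _ => Subtype.ext (by simp; module))
    (fun c _ _ => Subtype.ext (by
      simp [← Complex.coe_smul, smul_comm (c : ℂ), ← smul_sub]))).toContinuousBilinearMap

theorem perpCoForm_coe (z y : J.perp ((r : ℂ) • e)) : (perpCoForm he hr z y : V)
    = (r : ℂ)⁻¹ • J.D e ((chartGraph he hr).proj z) (y - (chartGraph he hr).proj y) := rfl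

/-- A normal frame along the first characteristic variety. At the point `r e + z` of the cone, where
`z` has the component `u` in `V₁(e)`, the orthogonal complement of the tangent space is
`exp(-r⁻¹ D(e, u)) V₀(e)`, the adjoint of the inverse of `exp(r⁻¹ D(u, e))` applied to `V₀(e)`. Its
elements are moved to the complement of `e` by adding a multiple of the base point. -/
noncomputable def normalFrame (z : J.perp ((r : ℂ) • e)) :
    J.perp ((r : ℂ) • e) →L[ℝ] J.perp ((r : ℂ) • e) :=
  LinearMap.toContinuousLinearMap
    { toFun := fun y => y - (chartGraph he hr).proj y - perpCoForm he hr z y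
        - (J.herm (perpCoForm he hr z y : V) (z : V)
          / (2 * J.herm ((r : ℂ) • e) ((r : ℂ) • e))) • z
      map_add' := fun a b => by
        simp only [map_add, Submodule.coe_add, herm_add_left, add_div]
        module
      map_smul' := fun c a => by
        have h1 : perpCoForm he hr z (c • a) = (c : ℂ) • perpCoForm he hr z a := by
          rw [map_smul]
          exact (Complex.coe_smul c _).symm
        have h2 : (chartGraph he hr).proj (c • a) = (c : ℂ) • (chartGraph he hr).proj a := by
          rw [← Complex.coe_smul, map_smul]
        rw [h1, h2, RingHom.id_apply, ← Complex.coe_smul, ← Complex.coe_smul, Submodule.coe_smul,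
          herm_smul_left, mul_div_assoc]
        module }

theorem normalFrame_apply (z y : J.perp ((r : ℂ) • e)) : normalFrame he hr z y
    = y - (chartGraph he hr).proj y - perpCoForm he hr z y
        - (J.herm (perpCoForm he hr z y : V) (z : V)
          / (2 * J.herm ((r : ℂ) • e) ((r : ℂ) • e))) • z := rfl

theorem normalFrame_zero (y : J.perp ((r : ℂ) • e)) :
    normalFrame he hr 0 y = y - (chartGraph he hr).proj y := by
  rw [normalFrame_apply]
  simp

theorem differentiable_normalFrame :
    Differentiable ℝ (normalFrame he hr) := by
  have h : ContDiff ℝ 1 (normalFrame he hr) := by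
    rw [contDiff_clm_apply_iff]
    intro y
    simp only [normalFrame_apply]
    have hincl : ContDiff ℝ 1 fun z : J.perp ((r : ℂ) • e) => (z : V) :=
      ((J.perp ((r : ℂ) • e)).subtypeL.restrictScalars ℝ).contDiff
    have h1 : ContDiff ℝ 1 fun z => perpCoForm he hr z y :=
      (perpCoForm he hr).contDiff.clm_apply contDiff_const
    have h2 : ContDiff ℝ 1 fun z => J.herm (perpCoForm he hr z y : V) (z : V) :=
      (J.hermL.contDiff.comp (hincl.comp h1)).clm_apply hincl
    exact (contDiff_const.sub h1).sub ((h2.div_const _).smul contDiff_id)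
  exact h.differentiable one_ne_zero

/-- The values of the normal frame are orthogonal to the tangent space of the variety, which
consists of the `t` whose component in `V₀(e)` is `r⁻¹ {z e t}`. -/
theorem fubiniStudy_normalFrame (hx : (r : ℂ) • e ≠ 0) (z : J.perp ((r : ℂ) • e))
    (hz : z ∈ (chartGraph he hr).carrier) (y t : J.perp ((r : ℂ) • e))
    (ht : t - (chartGraph he hr).proj t = (chartGraph he hr).form z t) :
    J.fubiniStudy ((r : ℂ) • e) z (normalFrame he hr z y) t = 0 := by
  obtain ⟨u, hu, w₀, hw₀, hzu⟩ := exists_perp_decomp he hr z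
  obtain ⟨v, hv, t₀, ht₀, htv⟩ := exists_perp_decomp he hr t
  obtain ⟨y₁, hy₁, w, hw, hyw⟩ := exists_perp_decomp he hr y
  have hpz := chartGraph_proj_coe he hr hu hw₀ hzu
  have hpt := chartGraph_proj_coe he hr hv ht₀ htv
  have hpy := chartGraph_proj_coe he hr hy₁ hw hyw
  have hw₀' : w₀ = (1 / 2 : ℂ) • (r : ℂ)⁻¹ • J.D u e u := by
    have := congrArg Subtype.val hz
    rw [Submodule.coe_sub, hpz, Submodule.coe_smul, chartGraph_form_coe, hzu,
      D_tripotent_of_add he.1 hu hw₀ hw₀, add_sub_cancel_left] at this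
    exact this
  have ht₀' : t₀ = (r : ℂ)⁻¹ • J.D u e v := by
    have := congrArg Subtype.val ht
    rw [Submodule.coe_sub, hpt, chartGraph_form_coe, hzu, htv,
      D_tripotent_of_add he.1 hu hw₀ ht₀, add_sub_cancel_left] at this
    exact this
  obtain ⟨x, hxdef⟩ : ∃ x, x = (r : ℂ) • e := ⟨_, rfl⟩
  obtain ⟨k, hk⟩ : ∃ k, k = (r : ℂ)⁻¹ • J.D e u w := ⟨_, rfl⟩
  have hkc : (perpCoForm he hr z y : V) = k := by
    rw [perpCoForm_coe, hpz, hpy, hyw, add_sub_cancel_left, hk]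
  have hk1 : k ∈ J.peirce e 1 := by
    have := J.peirce_rule (map_one _) (self_mem_peirce he.1) hu hw
    norm_num at this
    exact hk ▸ Submodule.smul_mem _ _ this
  have h01 : ∀ {a b : V}, a ∈ J.peirce e 0 → b ∈ J.peirce e 1 → J.herm a b = 0 :=
    fun ha hb => J.herm_peirce (map_one _) zero_ne_one ha hb
  have h10 : ∀ {a b : V}, a ∈ J.peirce e 1 → b ∈ J.peirce e 0 → J.herm a b = 0 :=
    fun ha hb => J.herm_peirce (map_zero _) one_ne_zero ha hb
  have hkz : J.herm k (z : V) = J.herm k u := by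
    rw [hzu, herm_add_right, h10 hk1 hw₀, add_zero]
  have hkr : ∀ b, J.herm k b = (r : ℂ)⁻¹ * J.herm w (J.D u e b) := by
    intro b
    rw [hk, herm_smul_left, herm_adjoint]
  have hwr : ∀ b, J.herm w ((r : ℂ)⁻¹ • b) = (r : ℂ)⁻¹ * J.herm w b := by
    intro b
    rw [herm_smul_right, map_inv₀, Complex.conj_ofReal]
  have hxx : J.herm x x ≠ 0 := hxdef ▸ J.herm_self_ne_zero hx
  obtain ⟨c, hc⟩ : ∃ c, c = J.herm k u / (2 * J.herm x x) := ⟨_, rfl⟩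
  have hc' : J.herm k u / (2 * J.herm ((r : ℂ) • e) ((r : ℂ) • e)) = c := by rw [hc, hxdef]
  have hn : (normalFrame he hr z y : V) = w - k + c • x - c • (x + z) := by
    rw [normalFrame_apply]
    simp only [Submodule.coe_sub, Submodule.coe_smul, hkc, hpy, hkz]
    rw [hyw, add_sub_cancel_left, hc']
    module
  have hxt : J.herm x (t : V) = 0 := by
    rw [← J.herm_conj, show J.herm (t : V) x = 0 from hxdef ▸ t.2, map_zero]
  have hxz : J.herm x (z : V) = 0 := by
    rw [← J.herm_conj, show J.herm (z : V) x = 0 from hxdef ▸ z.2, map_zero]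
  have hwx : J.herm w x = 0 := by
    rw [hxdef, herm_smul_right, J.herm_peirce (map_ofNat _ 2) (by norm_num) hw
      (self_mem_peirce he.1), mul_zero]
  have hkx : J.herm k x = 0 := by
    rw [hxdef, herm_smul_right, J.herm_peirce (map_ofNat _ 2) (by norm_num) hk1
      (self_mem_peirce he.1), mul_zero]
  -- `w - k + c x` is orthogonal to the tangent space of the cone at `x + z`
  have hnt : J.herm (w - k + c • x) (t : V) = 0 := by
    rw [herm_add_left, herm_sub_left, herm_smul_left, hxt, htv, herm_add_right, herm_add_right,
      h01 hw hv, h10 hk1 ht₀, ht₀', hwr, hkr]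
    ring
  have hny : J.herm (w - k + c • x) (x + z) = 0 := by
    have h2 : starRingEnd ℂ (1 / 2 : ℂ) = 1 / 2 := by simp [map_ofNat]
    have h3 : J.herm w (z : V) = (1 / 2) * J.herm k u := by
      rw [hzu, herm_add_right, h01 hw hu, hw₀', herm_smul_right, h2, hwr, hkr, zero_add]
    rw [herm_add_left, herm_sub_left, herm_smul_left, herm_add_right, herm_add_right,
      herm_add_right, hwx, hkx, hxz, hkz, h3, hc]
    field_simp
    ring
  have hN := herm_add_perp_self_ne_zero hx z
  generalize w - k + c • x = m at hn hnt hny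
  subst hxdef
  rw [fubiniStudy, hn]
  simp only [herm_sub_left, hnt, hny, herm_smul_left]
  rw [← Complex.zero_re]
  congr 1
  field_simp
  ring

end Normal

/-! ### The symmetries and the parallelism of the first characteristic variety -/

section Main

variable {V : Type*} [NormedAddCommGroup V] [NormedSpace ℂ V] [FiniteDimensional ℂ V]
  {J : PosHermJordanTriple V}

theorem isComplexSubmanifold_mokVariety : J.IsComplexSubmanifold (J.mokVariety 1) := by
  intro x hx hmem
  obtain ⟨e, r, he, hr, rfl⟩ := ((mk_mem_mokVariety_iff hx).mp hmem).exists_isPrimitive hx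
  rw [preimage_chart_eq he hr hx]
  exact (chartGraph he hr).exists_isLocalParam

theorem hasParallelSecondFF_mokVariety : J.HasParallelSecondFF (J.mokVariety 1) := by
  intro x hx hmem d W f hf h0 a b c
  obtain ⟨e, r, he, hr, rfl⟩ := ((mk_mem_mokVariety_iff hx).mp hmem).exists_isPrimitive hx
  rw [preimage_chart_eq he hr hx] at hf
  refine ChartGeometry.QuadraticGraph.derivSecondFF_eq_zero hf h0 fubiniStudy_sub_left
    (eq_zero_of_fubiniStudy_self hx) (christoffel_fubiniStudy hx) (fun u => ?_)
    (fubiniStudy_normalFrame he hr hx) (differentiable_normalFrame he hr 0)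
    (normalFrame_zero he hr) a b c
  have : J.herm (u : V) ((r : ℂ) • e) = 0 := u.2
  simp only [Submodule.coe_zero, add_zero]
  rw [this, zero_div]

omit [FiniteDimensional ℂ V] in
/-- Collinear tripotents have the same Peirce spaces. -/
theorem D_self_eq_of_smul {e e' : V} (he : J.IsTripotent e) (he' : J.IsTripotent e')
    (he0 : e' ≠ 0) {c : ℂ} (h : e' = c • e) : J.D e' e' = J.D e e := by
  have h1 : J.D e' e' = (c * starRingEnd ℂ c) • J.D e e := by
    rw [h]
    simp only [map_smul, map_smulₛₗ, LinearMap.smul_apply, smul_smul]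
    rw [mul_comm]
  have h2 := J.isTripotent_iff.mp he'
  have h3 : J.D e e e' = (2 : ℂ) • e' := by
    rw [h, map_smul, J.isTripotent_iff.mp he, smul_comm]
  rw [h1, LinearMap.smul_apply, h3, smul_smul] at h2
  have h4 := smul_left_injective ℂ he0 h2
  have h5 : c * starRingEnd ℂ c = 1 := by
    have h6 : (c * starRingEnd ℂ c) * 2 = 2 := h4
    linear_combination (1 / 2 : ℂ) * h6
  rw [h1, h5, one_smul]

/-- The map induced by the Peirce reflection of a primitive tripotent `e` is an extrinsic symmetry
at `[e]`: in the chart centred at a multiple of `e` it is linear, the tangent space is `V₁(e)` and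
the normal space is `V₀(e)`. -/
theorem IsPeirceReflection.isExtrinsicSymmetry {e : V} (he : J.IsPrimitive e) {σ : V ≃ₗ[ℂ] V}
    (hσ : J.IsPeirceReflection e σ) :
    J.IsExtrinsicSymmetry (J.mokVariety 1) (Projectivization.mk ℂ e he.2.1)
      (Projectivization.map σ.toLinearMap σ.injective) := by
  have haut := hσ.isAutomorphism he.1
  have hσe : σ e = e := hσ.2.2 e (self_mem_peirce he.1)
  refine ⟨haut.isFubiniStudyIsometry, ?_, haut.image_mokVariety, fun x hx hxe => ?_⟩
  · rw [Projectivization.map_mk]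
    simp [hσe]
  have hmem : Projectivization.mk ℂ x hx ∈ J.mokVariety 1 := by
    rw [hxe, mk_mem_mokVariety_iff]
    exact he.isRankOne
  obtain ⟨e', r, he', hr, rfl⟩ := ((mk_mem_mokVariety_iff hx).mp hmem).exists_isPrimitive hx
  obtain ⟨a, ha⟩ := (Projectivization.mk_eq_mk_iff' ℂ _ _ hx he.2.1).mp hxe
  have hr0 : (r : ℂ) ≠ 0 := by exact_mod_cast hr.ne'
  have he'e : e' = ((r : ℂ)⁻¹ * a) • e := by
    rw [mul_smul, ha, smul_smul, inv_mul_cancel₀ hr0, one_smul]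
  have hD := D_self_eq_of_smul he.1 he'.1 he'.2.1 he'e
  have hpeirce : ∀ c : ℂ, J.peirce e' c = J.peirce e c := fun c => by
    rw [peirce, peirce, hD]
  have hσx : σ ((r : ℂ) • e') = (1 : ℂ) • ((r : ℂ) • e') := by
    rw [he'e, map_smul, map_smul, hσe, one_smul]
  rw [preimage_chart_eq he' hr hx, ChartGeometry.QuadraticGraph.tangentSet_zero]
  refine ⟨haut.perpMap one_ne_zero hσx, haut.isChartRep hx hx one_ne_zero hσx,
    ((haut.perpMap one_ne_zero hσx).restrictScalars ℝ).differentiableAt, fun u hu => ?_,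
    fun ξ hξ => ?_⟩
  · have hu1 : (u : V) ∈ J.peirce e 1 := by
      rw [← hpeirce]
      exact (chartGraph_proj_eq_iff he' hr u).mp hu
    rw [haut.fderiv_perpMap]
    refine Subtype.ext ?_
    rw [haut.perpMap_coe, hσ.1 _ hu1]
    simp
  · obtain ⟨u, hu, w, hw, hξu⟩ := exists_perp_decomp he' hr ξ
    have hpξ := chartGraph_proj_coe he' hr hu hw hξu
    have h1 := hξ ((chartGraph he' hr).proj ξ) ((chartGraph he' hr).proj_proj ξ)
    rw [fubiniStudy_zero, hpξ, hξu, herm_add_left,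
      J.herm_peirce (map_one _) zero_ne_one hw hu, add_zero, J.herm_self_ofReal ((r : ℂ) • e'),
      Complex.div_ofReal_re] at h1
    have hu0 : u = 0 := by
      by_contra hne
      exact (div_pos (J.herm_self_pos hne) (J.herm_self_pos hx)).ne' h1
    rw [haut.fderiv_perpMap]
    refine Subtype.ext ?_
    rw [hpeirce] at hw
    rw [haut.perpMap_coe, hξu, hu0, zero_add, hσ.2.1 w hw]
    simp

theorem isExtrinsicallySymmetric_mokVariety : J.IsExtrinsicallySymmetric (J.mokVariety 1) := by
  refine ⟨isComplexSubmanifold_mokVariety, fun p hp => ?_⟩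
  induction p using Projectivization.ind with
  | h x hx =>
    obtain ⟨e, r, he, hr, rfl⟩ := ((mk_mem_mokVariety_iff hx).mp hp).exists_isPrimitive hx
    obtain ⟨σ, hσ, -⟩ := existsUnique_isPeirceReflection he.1
    have hmk : Projectivization.mk ℂ ((r : ℂ) • e) hx = Projectivization.mk ℂ e he.2.1 :=
      (Projectivization.mk_eq_mk_iff' ℂ _ _ _ _).mpr ⟨r, rfl⟩
    rw [hmk]
    exact ⟨_, hσ.isExtrinsicSymmetry he⟩

end Main

end PosHermJordanTriple

theorem mainTheorem6 {V : Type*} [NormedAddCommGroup V] [NormedSpace ℂ V] [FiniteDimensional ℂ V]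
    (D : Set V) (hD : IsCircledBoundedSymmetricDomain D)
    (J : PosHermJordanTriple V) (hJ : J.IsAssociatedTo D) :
    J.IsExtrinsicallySymmetric (J.mokVariety 1) ∧
    J.HasParallelSecondFF (J.mokVariety 1) ∧
    ∀ (e : V) (he : J.IsPrimitive e),
      Projectivization.mk ℂ e he.2.1 ∈ J.mokVariety 1 ∧
      (∃! σ : V ≃ₗ[ℂ] V, J.IsPeirceReflection e σ) ∧
      ∀ σ : V ≃ₗ[ℂ] V, J.IsPeirceReflection e σ →
        J.IsAutomorphism σ ∧
        J.IsExtrinsicSymmetry (J.mokVariety 1) (Projectivization.mk ℂ e he.2.1)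
          (Projectivization.map σ.toLinearMap σ.injective) :=
  ⟨PosHermJordanTriple.isExtrinsicallySymmetric_mokVariety,
    PosHermJordanTriple.hasParallelSecondFF_mokVariety, fun e he =>
      ⟨(PosHermJordanTriple.mk_mem_mokVariety_iff he.2.1).mpr he.isRankOne,
        PosHermJordanTriple.existsUnique_isPeirceReflection he.1, fun _ hσ =>
          ⟨hσ.isAutomorphism he.1, hσ.isExtrinsicSymmetry he⟩⟩⟩
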